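/- Let $(p_t)$ be a one-parameter family of laws on a measurable space and $P_\theta=p_{\theta_1}\times\cdots\times p_{\theta_d}$ for $\theta\in\Theta\subset\mathbb{R}^d$, $d\ge 1$. Let $\theta_0=(t_0,\dots,t_0)$ be an interior point of $\Theta$, and let $\delta_0,c_0,\rho>0$. Assume: (i) $(P_\theta)_{\theta\in\Theta}$ is differentiable in quadratic mean at $\theta_0$ with score $S_{\theta_0}$ and non-singular Fisher information matrix $I(\theta_0)$; $(p_t)$ has score $s_0$ (in quadratic mean) and Fisher information $I_0=\mathbb{E}_{p_{t_0}}[s_0(X)^2]$ at $t_0$. (ii) Let $B$ be the largest diagonal element of $I(\theta_0)$. For every $\delta>0$ with $\theta_0+\delta[-1,1]^d\subset\Theta$ and $\delta<\delta_0(B^2d)^{-1/4}$, the densities $\frac{dP_{\theta_0+\delta u}}{dP_{\theta_0}}$, $u\in\{\pm1\}^d$, exist and $$\mathbb{E}\left[\mathbb{E}_{U}\left(\tfrac{dP_{\theta_0+\delta U}}{dP_{\theta_0}}(X)-1\right)\left(\tfrac{dP_{\theta_0+\delta U}}{dP_{\theta_0}}(X')-1\right)-\delta^2S_{\theta_0}(X)^TS_{\theta_0}(X')\right]^2\le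 (c_0\delta^4B^2d)^2,$$ where $U$ is uniform on $\{\pm1\}^d$ and $X,X'\sim P_{\theta_0}$ are independent. (iii) $n\ge d^2$ and $\theta_0+\rho\sqrt{\tfrac{d}{nI_0}}\,[-1,1]^d\subset\Theta$. Let $X_1,\dots,X_n$ be i.i.d. with law $P_\theta$, the $i$-th one observed by sensor $i$. In a blackboard protocol the sensors write bits one after another on a board that everybody sees; who writes next is determined by the bits already on the board and the public randomness, and each bit may depend on these and on the writer's observation; each sensor may write at most one bit ($k=1$). Public randomness is available to all sensors and to the estimator. Then $$\inf_{\Pi_{\mathsf{BB}}}\inf_{\hat\theta}\sup_{\theta\in\Theta}\mathbb{E}_\theta\|\hat\theta-\theta\|_2^2\ \ge\ C\cdot\frac{d^2}{nI_0},$$ where the infimum is over all such protocols $\Pi_{\mathsf{BB}}$ and all estimators $\hat\theta$ based on the final transcript (and the public randomness), and the constant $C>0$ depends only on $\delta_0,c_0,\rho$; in particular it does not depend on $n$, $d$, $I_0$ or the model. -/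

import Mathlib

open MeasureTheory Filter Topology
open scoped ENNReal

universe u w

noncomputable section

namespace DistEst

/-! ### Statistical models -/

/-- Differentiability in quadratic mean of the model `P` at `θ₀` with score function `S`:
`∫ (√f_θ - √f_{θ₀} - ½ ⟨S, θ - θ₀⟩ √f_{θ₀})² dν = o(‖θ - θ₀‖²)` as `θ → θ₀`, where `f_θ`, `f_{θ₀}`
are densities of `P θ`, `P θ₀` with respect to a common dominating measure `ν`. The integral does
not depend on the choice of `ν`; here `ν = P θ + P θ₀`. -/
structure DiffQuadMean {𝓧 : Type*} [MeasurableSpace 𝓧] {E : Type*} [NormedAddCommGroup E]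
    [InnerProductSpace ℝ E] [MeasurableSpace E]
    (P : E → Measure 𝓧) (θ₀ : E) (S : 𝓧 → E) : Prop where
  measurable_score : Measurable S
  remainder : ∀ ε : ℝ, 0 < ε → ∀ᶠ θ in 𝓝 θ₀,
    ∫⁻ x, ENNReal.ofReal
        ((√((P θ).rnDeriv (P θ + P θ₀) x).toReal - √((P θ₀).rnDeriv (P θ + P θ₀) x).toReal
          - 1 / 2 * inner ℝ (S x) (θ - θ₀) * √((P θ₀).rnDeriv (P θ + P θ₀) x).toReal) ^ 2)
      ∂(P θ + P θ₀) ≤ ENNReal.ofReal (ε * ‖θ - θ₀‖ ^ 2)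

/-- The Fisher information `E[s(X)²]`, `X ∼ μ`, of a one-parameter model with score `s`. -/
def fisherInfo {𝓧 : Type*} [MeasurableSpace 𝓧] (μ : Measure 𝓧) (s : 𝓧 → ℝ) : ℝ :=
  ∫ x, s x ^ 2 ∂μ

/-- The Fisher information matrix `E[S(X) S(X)ᵀ]`, `X ∼ μ`, of a model with score `S`. -/
def fisherMatrix {𝓧 : Type*} [MeasurableSpace 𝓧] {d : ℕ} (μ : Measure 𝓧)
    (S : 𝓧 → EuclideanSpace ℝ (Fin d)) : Matrix (Fin d) (Fin d) ℝ :=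
  Matrix.of fun i j => ∫ x, S x i * S x j ∂μ

/-- The largest diagonal element of the Fisher information matrix. -/
def maxDiagFisher {𝓧 : Type*} [MeasurableSpace 𝓧] {d : ℕ} (μ : Measure 𝓧)
    (S : 𝓧 → EuclideanSpace ℝ (Fin d)) : ℝ :=
  ⨆ i, fisherMatrix μ S i i

/-- The model `(P θ)_{θ ∈ Θ}` is regular at the interior point `θ₀` of `Θ`: it is differentiable
in quadratic mean there, with score `S` and non-singular Fisher information matrix. -/
structure RegularAt {𝓧 : Type*} [MeasurableSpace 𝓧] {d : ℕ}
    (P : EuclideanSpace ℝ (Fin d) → Measure 𝓧) (Θ : Set (EuclideanSpace ℝ (Fin d)))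
    (θ₀ : EuclideanSpace ℝ (Fin d)) (S : 𝓧 → EuclideanSpace ℝ (Fin d)) : Prop where
  mem_interior : θ₀ ∈ interior Θ
  diffQuadMean : DiffQuadMean P θ₀ S
  nonsingular : (fisherMatrix (P θ₀) S).det ≠ 0

/-- The cube `θ₀ + δ [-1,1]^d`. -/
def cube {d : ℕ} (θ₀ : EuclideanSpace ℝ (Fin d)) (δ : ℝ) : Set (EuclideanSpace ℝ (Fin d)) :=
  {θ | ∀ i, |θ i - θ₀ i| ≤ δ}

/-- The vector of `{±1}^d ⊆ ℝ^d` with the signs `u`. -/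
def signVec {d : ℕ} (u : Fin d → ℤˣ) : EuclideanSpace ℝ (Fin d) :=
  WithLp.toLp 2 fun i => ((u i : ℤ) : ℝ)

/-- `E_U [(dP_{θ₀+δU}/dP_{θ₀}(x) - 1) (dP_{θ₀+δU}/dP_{θ₀}(x') - 1)]` with `U` uniformly
distributed on `{±1}^d`. -/
def likelihoodKernel {𝓧 : Type*} [MeasurableSpace 𝓧] {d : ℕ}
    (P : EuclideanSpace ℝ (Fin d) → Measure 𝓧) (θ₀ : EuclideanSpace ℝ (Fin d)) (δ : ℝ)
    (x x' : 𝓧) : ℝ :=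
  ((2 : ℝ) ^ d)⁻¹ * ∑ u : Fin d → ℤˣ,
    (((P (θ₀ + δ • signVec u)).rnDeriv (P θ₀) x).toReal - 1) *
      (((P (θ₀ + δ • signVec u)).rnDeriv (P θ₀) x').toReal - 1)

/-- The second-moment condition on the likelihood ratios near `θ₀`, with constants `δ₀`, `c₀`.
The likelihood ratios are required to exist (absolute continuity), and the second moment is taken
in `[0, ∞]`, so that its finiteness is part of the condition. -/
def LikelihoodCondition {𝓧 : Type*} [MeasurableSpace 𝓧] {d : ℕ}
    (P : EuclideanSpace ℝ (Fin d) → Measure 𝓧) (Θ : Set (EuclideanSpace ℝ (Fin d)))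
    (θ₀ : EuclideanSpace ℝ (Fin d)) (S : 𝓧 → EuclideanSpace ℝ (Fin d)) (δ₀ c₀ : ℝ) : Prop :=
  ∀ δ : ℝ, 0 < δ → cube θ₀ δ ⊆ Θ →
    δ < δ₀ * (maxDiagFisher (P θ₀) S ^ 2 * (d : ℝ)) ^ (-(1 / 4) : ℝ) →
    (∀ u : Fin d → ℤˣ, P (θ₀ + δ • signVec u) ≪ P θ₀) ∧
    ∫⁻ z : 𝓧 × 𝓧, ENNReal.ofReal
        ((likelihoodKernel P θ₀ δ z.1 z.2 - δ ^ 2 * inner ℝ (S z.1) (S z.2)) ^ 2)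
      ∂((P θ₀).prod (P θ₀))
      ≤ ENNReal.ofReal ((c₀ * δ ^ 4 * maxDiagFisher (P θ₀) S ^ 2 * (d : ℝ)) ^ 2)

/-- The product model `P_θ = p_{θ_1} × ⋯ × p_{θ_d}`. -/
def productModel {𝓧 : Type*} [MeasurableSpace 𝓧] (p : ℝ → Measure 𝓧) {d : ℕ}
    (θ : EuclideanSpace ℝ (Fin d)) : Measure (Fin d → 𝓧) :=
  Measure.pi fun i => p (θ i)

/-! ### Blackboard protocols -/

/-- A deterministic blackboard protocol of `n` sensors with observations in `𝓧`, as a binary tree.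
At an internal node the sensor `i` writes the bit `a (x i)` on the blackboard, and the protocol
continues in the right subtree if the bit is `1` (`true`) and in the left subtree if it is `0`. -/
inductive ProtocolTree (n : ℕ) (𝓧 : Type u) [MeasurableSpace 𝓧] : Type u
  | leaf : ProtocolTree n 𝓧
  | node (i : Fin n) (a : 𝓧 → Bool) (ha : Measurable a)
      (left right : ProtocolTree n 𝓧) : ProtocolTree n 𝓧

namespace ProtocolTree

variable {n : ℕ} {𝓧 : Type u} [MeasurableSpace 𝓧]

/-- The final transcript (all bits on the blackboard, in order) when sensor `i` observes `x i`. -/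
def transcript : ProtocolTree n 𝓧 → (Fin n → 𝓧) → List Bool
  | leaf, _ => []
  | node i a _ left right, x =>
      a (x i) :: (if a (x i) = true then right.transcript x else left.transcript x)

/-- The largest number of bits that sensor `j` writes on a path from the root to a leaf. -/
def bits : ProtocolTree n 𝓧 → Fin n → ℕ
  | leaf, _ => 0
  | node i _ _ left right, j => (if j = i then 1 else 0) + max (left.bits j) (right.bits j)

end ProtocolTree

/-- A blackboard protocol with public randomness, in which each of the `n` sensors writes at most
`k` bits: a public random seed `ω`, independent of the observations, selects a deterministic
protocol, and the transcript is jointly measurable in the seed and the observations. -/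
structure BlackboardProtocol (n k : ℕ) (𝓧 : Type u) [MeasurableSpace 𝓧] where
  Seed : Type w
  [measurableSpaceSeed : MeasurableSpace Seed]
  seedLaw : Measure Seed
  [isProbabilityMeasure_seedLaw : IsProbabilityMeasure seedLaw]
  tree : Seed → ProtocolTree n 𝓧
  bits_le : ∀ ω i, (tree ω).bits i ≤ k
  measurableSet_transcript : ∀ y : List Bool,
    MeasurableSet {z : Seed × (Fin n → 𝓧) | (tree z.1).transcript z.2 = y}

attribute [instance] BlackboardProtocol.measurableSpaceSeed
  BlackboardProtocol.isProbabilityMeasure_seedLaw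

/-- An estimator of a parameter in `ℝ^d`: a function of the public randomness and of the final
transcript, measurable in the former. -/
structure Estimator {n k : ℕ} {𝓧 : Type u} [MeasurableSpace 𝓧]
    (Pi : BlackboardProtocol.{u, w} n k 𝓧) (d : ℕ) where
  est : Pi.Seed → List Bool → EuclideanSpace ℝ (Fin d)
  measurable_est : ∀ y, Measurable fun ω => est ω y

/-- The risk `E_θ ‖θ̂ - θ‖₂²`, where `X_1, …, X_n` are i.i.d. with law `μ = P_θ`. -/
def risk {n k d : ℕ} {𝓧 : Type u} [MeasurableSpace 𝓧] (Pi : BlackboardProtocol.{u, w} n k 𝓧)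
    (T : Estimator Pi d) (μ : Measure 𝓧) (θ : EuclideanSpace ℝ (Fin d)) : ℝ≥0∞ :=
  ∫⁻ z : Pi.Seed × (Fin n → 𝓧),
      ENNReal.ofReal (‖T.est z.1 ((Pi.tree z.1).transcript z.2) - θ‖ ^ 2)
    ∂(Pi.seedLaw.prod (Measure.pi fun _ : Fin n => μ))

/-- The minimax risk: the infimum over all blackboard protocols with a budget of `k` bits per
sensor, and over all estimators, of the supremum over `θ ∈ Θ` of the risk. -/
def minimaxRisk {d : ℕ} {𝓧 : Type u} [MeasurableSpace 𝓧]
    (P : EuclideanSpace ℝ (Fin d) → Measure 𝓧) (Θ : Set (EuclideanSpace ℝ (Fin d)))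
    (n k : ℕ) : ℝ≥0∞ :=
  ⨅ (Pi : BlackboardProtocol.{u, w} n k 𝓧) (T : Estimator Pi d), ⨆ θ ∈ Θ, risk Pi T (P θ) θ

end DistEst

end

/-! The risk is bounded below by a Bayes risk, with the parameter uniform on the vertices of `t₀ +
[0, δ]^d`. The squared error splits over coordinates, and for coordinate `i` each vertex `b` with `b
i = false` is paired with its neighbour raised by `δ` in that coordinate. Estimating a two-valued
coordinate costs at least `δ²` times the sum, over transcripts, of `αβ/(α+β)` for the two transcript
weights (`square_add_square_ge`). Every bit lowers this quantity by at most its χ²-divergence,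
averaged along the path under the unraised law (`two_point_lower_bound`).

The decisive factor `d` comes from Bessel's inequality (`sum_sq_update_sub_le`). A bit is the
indicator of a set, and raising coordinate `i` changes its probability by the inner product of that
indicator with `φ(x_i)`, where `1 + φ` is the density of `p (t₀ + δ)` with respect to `p t₀`. The
functions `φ(x_i)` are centred and independent, so the χ²-divergences of one bit, summed over `i`,
are at most `χ = E φ²`, not `dχ`. At most `n` bits are written, hence the Bayes risk is at least `δ²
(d/4 - nχ)` (`sum_leafSum_ge`); public randomness merely averages this bound.

It remains to show `χ ≤ 2(δ² I₀ + c₀ δ⁴ I₀² d)`. The second-moment condition, tested against `g(x_i)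
g(x'_i)` for one coordinate `i`, controls `∫ g dp_{t₀+δ}` for bounded centred `g`
(`sq_integral_le_of_likelihoodKernel`), and duality turns this into a bound on `χ`
(`chiSq_le_of_test_functions`). Both this and the identity `B = I₀` rest on `score_ae_eq`. For `δ²`
a small multiple of `d/(nI₀)` and `n ≥ d²`, `nχ ≤ d/8`, which leaves a risk of at least `δ² d/8`. -/

noncomputable section

namespace DistEst

/-! ### Protocol trees and the two-point risk along a tree -/

namespace ProtocolTree

variable {n : ℕ} {𝓧 : Type u} [MeasurableSpace 𝓧]

/-- The expectation of a function of the final transcript, when all observations are independent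
with law `Q` and no sensor writes twice. -/
def leafSum (Q : Measure 𝓧) : ProtocolTree n 𝓧 → (List Bool → ℝ) → ℝ
  | leaf, F => F []
  | node _ a _ left right, F =>
      Q.real (a ⁻¹' {true}) * right.leafSum Q (fun y => F (true :: y)) +
        (1 - Q.real (a ⁻¹' {true})) * left.leafSum Q (fun y => F (false :: y))

/-- The expected sum, along the path of the protocol under `P`, of the `χ²`-divergences of the law
of the next bit under `Q` from its law under `P`. -/
def chiCost (P Q : Measure 𝓧) : ProtocolTree n 𝓧 → ℝ
  | leaf => 0
  | node _ a _ left right =>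
      (Q.real (a ⁻¹' {true}) - P.real (a ⁻¹' {true})) ^ 2 /
          (P.real (a ⁻¹' {true}) * (1 - P.real (a ⁻¹' {true}))) +
        (P.real (a ⁻¹' {true}) * right.chiCost P Q +
          (1 - P.real (a ⁻¹' {true})) * left.chiCost P Q)

/-- The length of the longest path from the root to a leaf. -/
def depth : ProtocolTree n 𝓧 → ℕ
  | leaf => 0
  | node _ _ _ left right => 1 + max left.depth right.depth

lemma depth_le_sum_bits (T : ProtocolTree n 𝓧) : T.depth ≤ ∑ j, T.bits j := by
  induction T with
  | leaf => simp [depth]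
  | node i a ha l r ihl ihr =>
    simp only [depth, bits, Finset.sum_add_distrib, Finset.sum_ite_eq', Finset.mem_univ, if_true]
    have h1 : ∑ j, l.bits j ≤ ∑ j, max (l.bits j) (r.bits j) :=
      Finset.sum_le_sum fun j _ => le_max_left _ _
    have h2 : ∑ j, r.bits j ≤ ∑ j, max (l.bits j) (r.bits j) :=
      Finset.sum_le_sum fun j _ => le_max_right _ _
    omega

lemma leafSum_finset_sum (Q : Measure 𝓧) {ι : Type*} (s : Finset ι) (T : ProtocolTree n 𝓧)
    (F : ι → List Bool → ℝ) :
    T.leafSum Q (fun y => ∑ i ∈ s, F i y) = ∑ i ∈ s, T.leafSum Q (F i) := by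
  induction T generalizing F with
  | leaf => simp [leafSum]
  | node i a ha l r ihl ihr =>
    simp only [leafSum, ihl, ihr, Finset.sum_add_distrib, Finset.mul_sum]

lemma leafSum_nonneg (Q : Measure 𝓧) [IsProbabilityMeasure Q] (T : ProtocolTree n 𝓧)
    (F : List Bool → ℝ) (hF : ∀ y, 0 ≤ F y) : 0 ≤ T.leafSum Q F := by
  induction T generalizing F with
  | leaf => exact hF []
  | node i a ha l r ihl ihr =>
    have h1 := ihl (fun y => F (false :: y)) fun y => hF _
    have h2 := ihr (fun y => F (true :: y)) fun y => hF _
    have h3 : Q.real (a ⁻¹' {true}) ≤ 1 := measureReal_le_one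
    have h4 : 0 ≤ 1 - Q.real (a ⁻¹' {true}) := by linarith
    simp only [leafSum]
    positivity

/-- On a rectangle that does not constrain the sensors which still write, the integral of a
function of the transcript factorizes. -/
lemma setLIntegral_transcript (Q : Measure 𝓧) [IsProbabilityMeasure Q] (T : ProtocolTree n 𝓧)
    (hT : ∀ j, T.bits j ≤ 1) (F : List Bool → ℝ) (hF : ∀ y, 0 ≤ F y)
    (s : Fin n → Set 𝓧) (hs : ∀ j, MeasurableSet (s j))
    (hs' : ∀ j, T.bits j ≠ 0 → s j = Set.univ) :
    ∫⁻ x in Set.univ.pi s, ENNReal.ofReal (F (T.transcript x)) ∂(Measure.pi fun _ => Q) =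
      (∏ j, Q (s j)) * ENNReal.ofReal (T.leafSum Q F) := by
  induction T generalizing F s with
  | leaf =>
    simp only [transcript, leafSum, lintegral_const, Measure.restrict_apply_univ, Measure.pi_pi]
    rw [mul_comm]
  | node i a ha l r ihl ihr =>
    have hb : ∀ j, l.bits j ≤ 1 ∧ r.bits j ≤ 1 ∧ (j = i → l.bits j = 0 ∧ r.bits j = 0) := by
      intro j
      have := hT j
      simp only [bits] at this
      refine ⟨by omega, by omega, fun h => ?_⟩
      rw [if_pos h] at this
      omega
    have hsi : s i = Set.univ := hs' i (by simp [bits])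
    -- Fixing the bit of sensor `i` shrinks the `i`-th side of the rectangle. Sensor `i` has then
    -- used its only bit, so the induction hypothesis still applies in the subtree; this is why the
    -- statement is about rectangles.
    have key : ∀ (v : Bool) (c : ProtocolTree n 𝓧), (∀ j, c.bits j ≤ 1) → c.bits i = 0 →
        (∀ j, c.bits j ≠ 0 → s j = Set.univ) →
        (∀ (F : List Bool → ℝ), (∀ y, 0 ≤ F y) → ∀ (s : Fin n → Set 𝓧),
          (∀ j, MeasurableSet (s j)) → (∀ j, c.bits j ≠ 0 → s j = Set.univ) →
          ∫⁻ x in Set.univ.pi s, ENNReal.ofReal (F (c.transcript x))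
            ∂(Measure.pi fun _ => Q) = (∏ j, Q (s j)) * ENNReal.ofReal (c.leafSum Q F)) →
        (∀ x, a (x i) = v → (node i a ha l r).transcript x = v :: c.transcript x) →
        ∫⁻ x in Set.univ.pi (Function.update s i (a ⁻¹' {v})),
          ENNReal.ofReal (F ((node i a ha l r).transcript x)) ∂(Measure.pi fun _ => Q) =
        (∏ j, Q (s j)) * (Q (a ⁻¹' {v}) * ENNReal.ofReal (c.leafSum Q fun y => F (v :: y))) := by
      intro v c hc1 hci hcs ih htr
      have hm : ∀ j, MeasurableSet (Function.update s i (a ⁻¹' {v}) j) := by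
        intro j
        rcases eq_or_ne j i with rfl | hj
        · simpa using ha (measurableSet_singleton v)
        · simpa [hj] using hs j
      rw [setLIntegral_congr_fun (g := fun x => ENNReal.ofReal (F (v :: c.transcript x)))
        (MeasurableSet.univ_pi hm)]
      · rw [ih (fun y => F (v :: y)) (fun y => hF _) _ hm, ← mul_assoc]
        · congr 1
          rw [← Finset.mul_prod_erase _ _ (Finset.mem_univ i),
            ← Finset.mul_prod_erase _ (fun j => Q (s j)) (Finset.mem_univ i), hsi, measure_univ,
            one_mul, mul_comm, Function.update_self]
          congr 1
          refine Finset.prod_congr rfl fun j hj => ?_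
          rw [Function.update_of_ne (Finset.ne_of_mem_erase hj)]
        · intro j hj
          have hji : j ≠ i := by rintro rfl; exact hj hci
          rw [Function.update_of_ne hji, hcs j hj]
      · intro x hx
        have : x i ∈ a ⁻¹' {v} := by simpa using hx i (Set.mem_univ i)
        simp only [htr x this]
    have hA : MeasurableSet {x : Fin n → 𝓧 | a (x i) = true} :=
      (ha.comp (measurable_pi_apply i)) (measurableSet_singleton true)
    have hsplit : ∀ v : Bool, Set.univ.pi (Function.update s i (a ⁻¹' {v})) =
        Set.univ.pi s ∩ {x | a (x i) = v} := by
      intro v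
      ext x
      simp only [Set.mem_pi, Set.mem_univ, true_imp_iff, Set.mem_inter_iff, Set.mem_ofPred_eq]
      constructor
      · intro h
        refine ⟨fun j => ?_, by simpa using h i⟩
        rcases eq_or_ne j i with rfl | hj
        · simp [hsi]
        · simpa [hj] using h j
      · rintro ⟨h, h'⟩ j
        rcases eq_or_ne j i with rfl | hj
        · simpa using h'
        · simpa [hj] using h j
    have htrue := key true r (fun j => (hb j).2.1) ((hb i).2.2 rfl).2
      (fun j hj => hs' j (by simp only [bits]; omega))
      (fun F hF s h1 h2 => ihr (fun j => (hb j).2.1) F hF s h1 h2)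
      (fun x hx => by simp [transcript, hx])
    have hfalse := key false l (fun j => (hb j).1) ((hb i).2.2 rfl).1
      (fun j hj => hs' j (by simp only [bits]; omega))
      (fun F hF s h1 h2 => ihl (fun j => (hb j).1) F hF s h1 h2)
      (fun x hx => by simp [transcript, hx])
    have hdiff : Set.univ.pi s \ {x : Fin n → 𝓧 | a (x i) = true} =
        Set.univ.pi s ∩ {x | a (x i) = false} := by
      ext x; simp
    rw [← lintegral_inter_add_sdiff _ _ hA, hdiff, ← hsplit, ← hsplit, htrue, hfalse, ← mul_add]
    congr 1
    have hcompl : a ⁻¹' {false} = (a ⁻¹' {true})ᶜ := by ext x; simp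
    have hq : Q.real (a ⁻¹' {false}) = 1 - Q.real (a ⁻¹' {true}) := by
      rw [hcompl, probReal_compl_eq_one_sub (ha (measurableSet_singleton true))]
    have hr := leafSum_nonneg Q r (fun y => F (true :: y)) fun y => hF _
    have hl := leafSum_nonneg Q l (fun y => F (false :: y)) fun y => hF _
    simp only [leafSum]
    rw [← hq, ENNReal.ofReal_add (by positivity) (by positivity), ENNReal.ofReal_mul (by positivity),
      ENNReal.ofReal_mul (by positivity), ofReal_measureReal, ofReal_measureReal]

lemma lintegral_transcript (Q : Measure 𝓧) [IsProbabilityMeasure Q] (T : ProtocolTree n 𝓧)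
    (hT : ∀ j, T.bits j ≤ 1) (F : List Bool → ℝ) (hF : ∀ y, 0 ≤ F y) :
    ∫⁻ x, ENNReal.ofReal (F (T.transcript x)) ∂(Measure.pi fun _ => Q) =
      ENNReal.ofReal (T.leafSum Q F) := by
  simpa using setLIntegral_transcript Q T hT F hF (fun _ => Set.univ)
    (fun _ => MeasurableSet.univ) fun _ _ => rfl

/-- The loss of the Bayes risk `αβ/(α+β)` of testing `α P` against `β Q` by observing a bit with
success probabilities `p` and `q`. -/
lemma harmonic_loss {α β p q : ℝ} (hα : 0 ≤ α) (hβ : 0 ≤ β) (hp0 : 0 ≤ p) (hp1 : p ≤ 1)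
    (hq0 : 0 ≤ q) (hq1 : q ≤ 1) (h0 : p * (1 - p) = 0 → q = p) :
    α * β / (α + β) - α * ((q - p) ^ 2 / (p * (1 - p))) ≤
      (α * p) * (β * q) / (α * p + β * q) +
        (α * (1 - p)) * (β * (1 - q)) / (α * (1 - p) + β * (1 - q)) := by
  by_cases hpp : p * (1 - p) = 0
  -- A bit that is constant under the first law is constant under the second, and its cost is a
  -- division by zero, hence `0`.
  · have hqp := h0 hpp
    subst hqp
    rcases mul_eq_zero.1 hpp with h | h
    · subst h; simp
    · have : q = 1 := by linarith
      subst this; simp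
  rcases hα.eq_or_lt with rfl | hα
  · simp
  have hp0' : 0 < p := hp0.lt_of_ne fun h => hpp (by simp [← h])
  have hp1' : 0 < 1 - p := by
    rcases (sub_nonneg.2 hp1).eq_or_lt with h | h
    · exact absurd (by rw [← h, mul_zero]) hpp
    · exact h
  have hq1' : 0 ≤ 1 - q := by linarith
  have hm : 0 < α * p + β * q := by positivity
  have hm' : 0 < α * (1 - p) + β * (1 - q) := by positivity
  have hs : 0 < α + β := by positivity
  have e : α * β / (α + β) - ((α * p) * (β * q) / (α * p + β * q) +
      (α * (1 - p)) * (β * (1 - q)) / (α * (1 - p) + β * (1 - q))) =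
      α ^ 2 * β ^ 2 * (q - p) ^ 2 /
        ((α + β) * (α * p + β * q) * (α * (1 - p) + β * (1 - q))) := by
    field_simp
    ring
  have h : α ^ 2 * β ^ 2 * (q - p) ^ 2 /
        ((α + β) * (α * p + β * q) * (α * (1 - p) + β * (1 - q))) ≤
      α * ((q - p) ^ 2 / (p * (1 - p))) := by
    rw [← mul_div_assoc, div_le_div_iff₀ (by positivity) (by positivity)]
    have key : α * β ^ 2 * (p * (1 - p)) ≤
        (α + β) * (α * p + β * q) * (α * (1 - p) + β * (1 - q)) := by
      -- Sorted by powers of `α` and `β`, only the coefficient of `α * β ^ 2` has a negative term;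
      -- `e3` shows that this coefficient is still nonnegative.
      have e2 : (α + β) * (α * p + β * q) * (α * (1 - p) + β * (1 - q)) -
          α * β ^ 2 * (p * (1 - p)) = α ^ 3 * (p * (1 - p)) + α ^ 2 * β * (p * (1 - p))
          + α ^ 2 * β * (p * (1 - q) + q * (1 - p)) +
          α * β ^ 2 * (p * (1 - q) + q * (1 - p) + q * (1 - q) - p * (1 - p))
          + β ^ 3 * (q * (1 - q)) := by ring
      have e3 : p * (1 - q) + q * (1 - p) + q * (1 - q) - p * (1 - p) =
          (q - p) ^ 2 + 2 * q * (1 - q) := by ring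
      have : 0 ≤ q * (1 - q) := by positivity
      have : 0 ≤ (q - p) ^ 2 + 2 * q * (1 - q) := by positivity
      rw [← sub_nonneg, e2, e3]
      positivity
    have : 0 ≤ α * (q - p) ^ 2 := by positivity
    nlinarith [mul_le_mul_of_nonneg_left key this]
  linarith

/-- With `a = x - t` and `b = x - (t + δ)`, this is `(α + β)(α a² + β b²) = αβ (a - b)² + (α a + β
b)²`. -/
lemma square_add_square_ge {α β : ℝ} (hα : 0 ≤ α) (hβ : 0 ≤ β) (x t δ : ℝ) :
    δ ^ 2 * (α * β / (α + β)) ≤ α * (x - t) ^ 2 + β * (x - (t + δ)) ^ 2 := by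
  rcases (add_nonneg hα hβ).eq_or_lt with h | h
  · rw [← h, div_zero, mul_zero]; positivity
  rw [← mul_div_assoc, div_le_iff₀ h]
  nlinarith [sq_nonneg (α * (x - t) + β * (x - (t + δ)))]

/-- Lower bound for the Bayes risk of estimating a parameter with the two values `t`, `t + δ`. -/
lemma two_point_lower_bound (P Q : Measure 𝓧) [IsProbabilityMeasure P] [IsProbabilityMeasure Q]
    (hPQ : ∀ A, MeasurableSet A → P.real A * (1 - P.real A) = 0 → Q.real A = P.real A)
    (t δ : ℝ) (T : ProtocolTree n 𝓧) (g : List Bool → ℝ) {α β : ℝ} (hα : 0 ≤ α) (hβ : 0 ≤ β) :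
    δ ^ 2 * (α * β / (α + β) - α * T.chiCost P Q) ≤
      α * T.leafSum P (fun y => (g y - t) ^ 2) +
        β * T.leafSum Q (fun y => (g y - (t + δ)) ^ 2) := by
  induction T generalizing g α β with
  | leaf =>
    simp only [chiCost, leafSum]
    simpa using square_add_square_ge hα hβ (g []) t δ
  | node i a ha l r ihl ihr =>
    simp only [chiCost, leafSum]
    set p := P.real (a ⁻¹' {true}) with hp
    set q := Q.real (a ⁻¹' {true}) with hq
    have hp0 : 0 ≤ p := measureReal_nonneg
    have hp1 : p ≤ 1 := measureReal_le_one
    have hq0 : 0 ≤ q := measureReal_nonneg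
    have hq1 : q ≤ 1 := measureReal_le_one
    -- The weights are unnormalised: each is multiplied by the probability of the bit just written.
    -- `harmonic_loss` then pays for the node itself.
    have h1 := ihr (fun y => g (true :: y)) (mul_nonneg hα hp0) (mul_nonneg hβ hq0)
    have h2 := ihl (fun y => g (false :: y)) (mul_nonneg hα (sub_nonneg.2 hp1))
      (mul_nonneg hβ (sub_nonneg.2 hq1))
    have h3 := mul_le_mul_of_nonneg_left (harmonic_loss hα hβ hp0 hp1 hq0 hq1
      (hPQ _ (ha (measurableSet_singleton true)))) (sq_nonneg δ)
    nlinarith [h1, h2, h3]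

/-- All the costs are averaged along paths under the same law `P`, so the sum over `i` can be taken
node by node, where `hQ` bounds it by `χ` whatever the number of alternatives. -/
lemma sum_chiCost_le (P : Measure 𝓧) [IsProbabilityMeasure P] {ι : Type*} (s : Finset ι)
    (Q : ι → Measure 𝓧) {χ : ℝ} (hχ : 0 ≤ χ)
    (hQ : ∀ A, MeasurableSet A →
      ∑ i ∈ s, ((Q i).real A - P.real A) ^ 2 ≤ χ * (P.real A * (1 - P.real A)))
    (T : ProtocolTree n 𝓧) : ∑ i ∈ s, T.chiCost P (Q i) ≤ χ * T.depth := by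
  induction T with
  | leaf => simp [chiCost, depth]
  | node i a ha l r ihl ihr =>
    simp only [chiCost, depth, Finset.sum_add_distrib, ← Finset.mul_sum, ← Finset.sum_div]
    have h := hQ _ (ha (measurableSet_singleton true))
    set p := P.real (a ⁻¹' {true}) with hp
    have hp0 : 0 ≤ p := measureReal_nonneg
    have hp1 : p ≤ 1 := measureReal_le_one
    have hpp : 0 ≤ p * (1 - p) := mul_nonneg hp0 (sub_nonneg.2 hp1)
    have h1 := div_le_of_le_mul₀ hpp hχ h
    have hd : (l.depth : ℝ) ≤ (max l.depth r.depth : ℕ) := by exact_mod_cast le_max_left _ _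
    have hd' : (r.depth : ℝ) ≤ (max l.depth r.depth : ℕ) := by exact_mod_cast le_max_right _ _
    have h2 := mul_le_mul_of_nonneg_left (ihr.trans (mul_le_mul_of_nonneg_left hd' hχ)) hp0
    have h3 := mul_le_mul_of_nonneg_left (ihl.trans (mul_le_mul_of_nonneg_left hd hχ))
      (sub_nonneg.2 hp1)
    rw [Nat.cast_add, Nat.cast_one]
    linarith

end ProtocolTree

/-! ### Perturbing one factor of a product measure -/

section ProductMeasure

variable {ι : Type*} {𝓧 : Type u} [MeasurableSpace 𝓧]

lemma sigmaFinite_update [DecidableEq ι] (m : ι → Measure 𝓧) [∀ j, SigmaFinite (m j)] (i : ι)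
    (ν : Measure 𝓧) [SigmaFinite ν] (j : ι) : SigmaFinite (Function.update m i ν j) := by
  rcases eq_or_ne j i with rfl | hj
  · rw [Function.update_self]; infer_instance
  · rw [Function.update_of_ne hj]; infer_instance

lemma isProbabilityMeasure_update [DecidableEq ι] (m : ι → Measure 𝓧)
    [∀ j, IsProbabilityMeasure (m j)] (i : ι) (ν : Measure 𝓧) [IsProbabilityMeasure ν] (j : ι) :
    IsProbabilityMeasure (Function.update m i ν j) := by
  rcases eq_or_ne j i with rfl | hj
  · rw [Function.update_self]; infer_instance
  · rw [Function.update_of_ne hj]; infer_instance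

variable [Fintype ι]

/-- Changing one factor of a product measure changes the density in one coordinate. -/
lemma pi_update_eq_withDensity [DecidableEq ι] (m : ι → Measure 𝓧)
    [∀ j, IsProbabilityMeasure (m j)] (i : ι) (ν : Measure 𝓧) [SigmaFinite ν] (hν : ν ≪ m i) :
    Measure.pi (Function.update m i ν) =
      (Measure.pi m).withDensity fun x => ν.rnDeriv (m i) (x i) := by
  have := sigmaFinite_update m i ν
  refine (Measure.pi_eq fun s hs => ?_)
  rw [withDensity_apply _ (MeasurableSet.univ_pi hs),
    ← lintegral_indicator (MeasurableSet.univ_pi hs)]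
  set g : ι → 𝓧 → ℝ≥0∞ := fun j =>
    (s j).indicator (if j = i then ν.rnDeriv (m i) else 1) with hg
  have hgm : ∀ j, Measurable (g j) := by
    intro j
    refine Measurable.indicator ?_ (hs j)
    split_ifs
    · exact Measure.measurable_rnDeriv _ _
    · exact measurable_one
  have hind : ProbabilityTheory.iIndepFun (fun j (x : ι → 𝓧) => g j (x j)) (Measure.pi m) :=
    ProbabilityTheory.iIndepFun_pi fun j => (hgm j).aemeasurable
  have h := ProbabilityTheory.lintegral_prod_eq_prod_lintegral_of_indepFun Finset.univ _ hind
    fun j => (hgm j).comp (measurable_pi_apply j)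
  rw [show (fun x : ι → 𝓧 => (Set.univ.pi s).indicator (fun x => ν.rnDeriv (m i) (x i)) x) =
    fun x => ∏ j, g j (x j) from ?_, h]
  · refine Finset.prod_congr rfl fun j _ => ?_
    rw [(measurePreserving_eval m j).lintegral_comp (hgm j), hg]
    simp only
    rw [lintegral_indicator (hs j)]
    rcases eq_or_ne j i with rfl | hj
    · rw [if_pos rfl, Function.update_self, Measure.setLIntegral_rnDeriv hν]
    · simp [hj]
  · funext x
    by_cases hx : x ∈ Set.univ.pi s
    · rw [Set.indicator_of_mem hx, ← Finset.mul_prod_erase _ _ (Finset.mem_univ i)]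
      have hx' : ∀ j, x j ∈ s j := fun j => hx j (Set.mem_univ j)
      rw [Finset.prod_eq_one]
      · simp [hg, hx' i]
      · intro j hj
        simp [hg, hx' j, Finset.ne_of_mem_erase hj]
    · rw [Set.indicator_of_notMem hx]
      simp only [Set.mem_pi, Set.mem_univ, true_imp_iff, not_forall] at hx
      obtain ⟨j, hj⟩ := hx
      exact (Finset.prod_eq_zero (Finset.mem_univ j) (by simp [hg, hj])).symm

lemma memLp_two_of_lintegral_sq_lt_top {α : Type*} [MeasurableSpace α] {μ : Measure α}
    {f : α → ℝ} (hf : AEStronglyMeasurable f μ)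
    (h : ∫⁻ x, ENNReal.ofReal (f x ^ 2) ∂μ < ∞) : MemLp f 2 μ := by
  rw [memLp_two_iff_integrable_sq hf]
  refine ⟨hf.pow 2, ?_⟩
  rwa [hasFiniteIntegral_iff_ofReal (ae_of_all _ fun x => sq_nonneg (f x))]

open ProbabilityTheory in
/-- Bessel's inequality for one-coordinate perturbations of a product measure. -/
lemma sum_sq_update_sub_le [DecidableEq ι] (m : ι → Measure 𝓧)
    [∀ j, IsProbabilityMeasure (m j)] (μ ν : Measure 𝓧) [IsProbabilityMeasure μ]
    [IsProbabilityMeasure ν] (hν : ν ≪ μ) {χ : ℝ} (hχ : 0 < χ)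
    (hfχ : ∫⁻ x, ENNReal.ofReal (((ν.rnDeriv μ x).toReal - 1) ^ 2) ∂μ ≤ ENNReal.ofReal χ)
    (s : Finset ι) (hs : ∀ i ∈ s, m i = μ) (A : Set (ι → 𝓧)) (hA : MeasurableSet A) :
    ∑ i ∈ s, ((Measure.pi (Function.update m i ν)).real A - (Measure.pi m).real A) ^ 2 ≤
      χ * ((Measure.pi m).real A * (1 - (Measure.pi m).real A)) := by
  set P := Measure.pi m with hP
  set φ : 𝓧 → ℝ := fun x => (ν.rnDeriv μ x).toReal - 1 with hφ
  have hφm : Measurable φ := (Measure.measurable_rnDeriv _ _).ennreal_toReal.sub_const 1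
  have hφL : MemLp φ 2 μ := memLp_two_of_lintegral_sq_lt_top hφm.aestronglyMeasurable
    (hfχ.trans_lt ENNReal.ofReal_lt_top)
  have hfi : Integrable (fun x => (ν.rnDeriv μ x).toReal) μ := Measure.integrable_toReal_rnDeriv
  have hφ0 : ∫ x, φ x ∂μ = 0 := by
    rw [hφ, integral_sub hfi (integrable_const _), Measure.integral_toReal_rnDeriv hν]
    simp
  have hφ2 : ∫ x, φ x ^ 2 ∂μ ≤ χ := by
    rw [integral_eq_lintegral_of_nonneg_ae (ae_of_all _ fun x => sq_nonneg _)
      (hφm.pow_const 2).aestronglyMeasurable]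
    exact ENNReal.toReal_le_of_le_ofReal hχ.le hfχ
  have hmp : ∀ i ∈ s, MeasurePreserving (fun x : ι → 𝓧 => x i) P μ := fun i hi => by
    rw [← hs i hi]; exact measurePreserving_eval m i
  set v : ι → ℝ := fun i => (Measure.pi (Function.update m i ν)).real A - P.real A with hv
  have hpL : ∀ i ∈ s, MemLp (fun x : ι → 𝓧 => φ (x i)) 2 P := fun i hi =>
    hφL.comp_measurePreserving (hmp i hi)
  have hp0 : ∀ i ∈ s, ∫ x, φ (x i) ∂P = 0 := fun i hi => by
    rw [← hφ0, ← (hmp i hi).map_eq, integral_map (measurable_pi_apply i).aemeasurable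
      hφm.aestronglyMeasurable]
  -- The change of probability is the inner product of the indicator of `A` with `φ (x i)`.
  have hv' : ∀ i ∈ s, ∫ x in A, φ (x i) ∂P = v i := by
    intro i hi
    have hi' := hs i hi
    have hfi' : Integrable (fun x : ι → 𝓧 => (ν.rnDeriv μ (x i)).toReal) P :=
      (hmp i hi).integrable_comp_of_integrable hfi
    rw [hφ, integral_sub hfi'.integrableOn (integrable_const _)]
    simp only [integral_const, smul_eq_mul, mul_one, hv, measureReal_restrict_apply_univ]
    congr 1
    rw [pi_update_eq_withDensity m i ν (hi' ▸ hν), hi', measureReal_def, withDensity_apply _ hA]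
    refine integral_toReal
      ((Measure.measurable_rnDeriv _ _).comp (measurable_pi_apply i)).aemeasurable ?_
    exact ae_restrict_of_ae ((hmp i hi).quasiMeasurePreserving.ae (Measure.rnDeriv_lt_top ν μ))
  set X : (ι → 𝓧) → ℝ := A.indicator 1 with hX
  have hXL : MemLp X 2 P := memLp_indicator_const 2 hA (1 : ℝ) (Or.inr (measure_ne_top _ _))
  have hXi : ∫ x, X x ∂P = P.real A := integral_indicator_one hA
  have hXvar : Var[X; P] = P.real A * (1 - P.real A) := by
    rw [variance_eq_sub hXL, hXi]
    have : X ^ 2 = X := by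
      funext x
      by_cases hx : x ∈ A <;> simp [hX, hx]
    rw [this, hXi]; ring
  set V := ∑ i ∈ s, v i ^ 2 with hV
  set Y : ι → (ι → 𝓧) → ℝ := fun i x => v i * φ (x i) with hY
  have hYL : ∀ i ∈ s, MemLp (Y i) 2 P := fun i hi => (hpL i hi).const_mul (v i)
  have hcov : cov[X, ∑ i ∈ s, Y i; P] = V := by
    rw [covariance_sum_right' hYL hXL]
    refine Finset.sum_congr rfl fun i hi => ?_
    rw [hY, covariance_const_mul_right, covariance_eq_sub hXL (hpL i hi), hp0 i hi, mul_zero,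
      sub_zero, sq, ← hv' i hi, ← integral_indicator hA]
    congr 2
    funext x
    by_cases hx : x ∈ A <;> simp [hX, hx]
  have hvar : Var[∑ i ∈ s, Y i; P] ≤ χ * V := by
    rw [IndepFun.variance_sum hYL]
    · rw [hV, Finset.mul_sum]
      refine Finset.sum_le_sum fun i hi => ?_
      rw [hY, variance_const_mul, mul_comm]
      refine mul_le_mul_of_nonneg_right ?_ (sq_nonneg _)
      refine (variance_le_expectation_sq (hpL i hi).aestronglyMeasurable).trans ?_
      refine le_trans (le_of_eq ?_) hφ2
      rw [← (hmp i hi).map_eq, integral_map (measurable_pi_apply i).aemeasurable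
        (hφm.pow_const 2).aestronglyMeasurable]
      rfl
    · intro i _ j _ hij
      exact (iIndepFun_pi (μ := m) (X := fun i x => v i * φ x)
        fun i => (hφm.const_mul (v i)).aemeasurable).indepFun hij
  -- Bessel's inequality: the multiplier `χ⁻¹` minimises `Var X - 2λV + λ²χV`, the bound on the
  -- variance of `X - λ ∑ Y i` given by `hcov` and `hvar`.
  have h0 := variance_nonneg (X - χ⁻¹ • ∑ i ∈ s, Y i) P
  have hSL : MemLp (∑ i ∈ s, Y i) 2 P := memLp_finsetSum' s hYL
  rw [variance_sub hXL (hSL.const_smul _), covariance_smul_right, variance_smul, hcov, hXvar] at h0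
  have h1 := mul_le_mul_of_nonneg_left hvar (sq_nonneg χ⁻¹)
  have h2 : 0 ≤ P.real A * (1 - P.real A) - χ⁻¹ * V := by
    have : χ⁻¹ ^ 2 * (χ * V) = χ⁻¹ * V := by field_simp
    linarith
  have h3 := mul_nonneg hχ.le h2
  have : χ * (χ⁻¹ * V) = V := by field_simp
  linarith

end ProductMeasure

/-! ### Bayes risk over the vertices of a cube -/

section Protocol

variable {𝓧 : Type u} [MeasurableSpace 𝓧]

/-- The vertex of the cube `t + [0, δ]^d` with coordinates `t + δ` where `b` is `true`. -/
def vertex {d : ℕ} (t δ : ℝ) (b : Fin d → Bool) : EuclideanSpace ℝ (Fin d) :=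
  WithLp.toLp 2 fun i => if b i = true then t + δ else t

/-- The product measure with factors `ν` where `b` is `true` and `μ` elsewhere. -/
def vertexLaw {d : ℕ} (μ ν : Measure 𝓧) (b : Fin d → Bool) : Measure (Fin d → 𝓧) :=
  Measure.pi fun i => if b i = true then ν else μ

lemma isProbabilityMeasure_ite (μ ν : Measure 𝓧) [IsProbabilityMeasure μ]
    [IsProbabilityMeasure ν] (c : Bool) : IsProbabilityMeasure (if c = true then ν else μ) := by
  split_ifs <;> infer_instance

instance {d : ℕ} (μ ν : Measure 𝓧) [IsProbabilityMeasure μ] [IsProbabilityMeasure ν]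
    (b : Fin d → Bool) : IsProbabilityMeasure (vertexLaw μ ν b) := by
  have := fun i => isProbabilityMeasure_ite μ ν (b i)
  unfold vertexLaw
  infer_instance

/-- Sum over the vertices of a cube, by pairs which differ in coordinate `i`. -/
lemma sum_bool_eq_sum_pairs {ι : Type*} [Fintype ι] [DecidableEq ι] (i : ι)
    (G : (ι → Bool) → ℝ) :
    ∑ b, G b = ∑ b with b i = false, (G b + G (Function.update b i true)) := by
  rw [← Finset.sum_filter_add_sum_filter_not _ (fun b : ι → Bool => b i = false),
    Finset.sum_add_distrib]
  congr 1
  symm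
  refine Finset.sum_nbij' (fun b => Function.update b i true)
    (fun b => Function.update b i false) ?_ ?_ ?_ ?_ ?_
  · intro b _; simp
  · intro b _; simp
  · intro b hb
    have hb' : b i = false := by simpa using hb
    simp [← hb']
  · intro b hb
    have hb' : b i = true := by simpa using hb
    simp [← hb']
  · intro b _; rfl

lemma card_filter_eq_false {ι : Type*} [Fintype ι] [DecidableEq ι] (i : ι) :
    ((Finset.univ.filter fun b : ι → Bool => b i = false).card : ℝ) =
      2 ^ Fintype.card ι / 2 := by
  have h := sum_bool_eq_sum_pairs i fun _ => (1 : ℝ)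
  simp only [Finset.sum_const, nsmul_eq_mul, Finset.card_univ, Fintype.card_fun,
    Fintype.card_bool] at h
  push_cast at h
  linarith

/-- Lower bound for the Bayes risk of a deterministic protocol with one bit per sensor, when the
parameter is uniformly distributed on the vertices of a cube. -/
lemma sum_leafSum_ge {n d : ℕ} (μ ν : Measure 𝓧) [IsProbabilityMeasure μ]
    [IsProbabilityMeasure ν] (hν : ν ≪ μ) {χ : ℝ} (hχ : 0 < χ)
    (hfχ : ∫⁻ x, ENNReal.ofReal (((ν.rnDeriv μ x).toReal - 1) ^ 2) ∂μ ≤ ENNReal.ofReal χ)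
    (t δ : ℝ) (T : ProtocolTree n (Fin d → 𝓧)) (hT : ∀ j, T.bits j ≤ 1)
    (e : List Bool → EuclideanSpace ℝ (Fin d)) :
    2 ^ d * (δ ^ 2 * (d / 4 - n * χ)) ≤
      ∑ b, T.leafSum (vertexLaw μ ν b) fun y => ‖e y - vertex t δ b‖ ^ 2 := by
  have hupd : ∀ (b : Fin d → Bool) (i : Fin d), vertexLaw μ ν (Function.update b i true) =
      Measure.pi (Function.update (fun j => if b j = true then ν else μ) i ν) := by
    intro b i
    unfold vertexLaw
    congr 1
    funext j
    rcases eq_or_ne j i with rfl | hj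
    · simp
    · simp [hj]
  -- Only the coordinates with `b i = false` have the factor `μ`, so that raising any of them is the
  -- same perturbation from `μ` to `ν`.
  have hbes : ∀ (b : Fin d → Bool) (A : Set (Fin d → 𝓧)), MeasurableSet A →
      ∑ i with b i = false, ((vertexLaw μ ν (Function.update b i true)).real A -
        (vertexLaw μ ν b).real A) ^ 2 ≤
      χ * ((vertexLaw μ ν b).real A * (1 - (vertexLaw μ ν b).real A)) := by
    intro b A hA
    have := fun i => isProbabilityMeasure_ite μ ν (b i)
    simp only [hupd]
    exact sum_sq_update_sub_le _ μ ν hν hχ hfχ _ (fun i hi => by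
      have : b i = false := by simpa using hi
      simp [this]) A hA
  have hnorm : ∀ b : Fin d → Bool, (fun y => ‖e y - vertex t δ b‖ ^ 2) =
      fun y => ∑ i, (e y i - vertex t δ b i) ^ 2 := by
    intro b
    funext y
    rw [EuclideanSpace.norm_sq_eq]
    simp
  have hpair : ∀ (b : Fin d → Bool) (i : Fin d), b i = false →
      δ ^ 2 * (1 / 2 - T.chiCost (vertexLaw μ ν b) (vertexLaw μ ν (Function.update b i true))) ≤
      T.leafSum (vertexLaw μ ν b) (fun y => (e y i - vertex t δ b i) ^ 2) +
      T.leafSum (vertexLaw μ ν (Function.update b i true))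
        (fun y => (e y i - vertex t δ (Function.update b i true) i) ^ 2) := by
    intro b i hbi
    have h := ProtocolTree.two_point_lower_bound (vertexLaw μ ν b)
      (vertexLaw μ ν (Function.update b i true)) (fun A hA h0 => by
        have h1 := hbes b A hA
        rw [h0, mul_zero] at h1
        have h2 := (Finset.single_le_sum (f := fun i =>
          ((vertexLaw μ ν (Function.update b i true)).real A - (vertexLaw μ ν b).real A) ^ 2)
          (fun j _ => sq_nonneg _) (by simpa using hbi :
            i ∈ Finset.univ.filter fun i => b i = false)).trans h1
        have h3 := pow_eq_zero_iff (two_ne_zero) |>.1 (le_antisymm h2 (sq_nonneg _))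
        linarith) t δ T (fun y => e y i) zero_le_one zero_le_one
    have e1 : vertex t δ b i = t := by simp [vertex, hbi]
    have e2 : vertex t δ (Function.update b i true) i = t + δ := by simp [vertex]
    rw [e1, e2]
    norm_num at h ⊢
    exact h
  have hdepth : (T.depth : ℝ) ≤ n := by
    have h1 : ∑ j, T.bits j ≤ n := by
      simpa using Finset.sum_le_sum fun j (_ : j ∈ Finset.univ) => hT j
    exact_mod_cast T.depth_le_sum_bits.trans h1
  -- Each of the `d` coordinates has `2 ^ d / 2` pairs, and each pair contributes `αβ/(α+β) = 1/2`
  -- for unit weights. The costs are regrouped by the lower vertex `b`, for which Bessel bounds the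
  -- sum over all coordinates at once.
  calc 2 ^ d * (δ ^ 2 * (d / 4 - n * χ))
      = ∑ i : Fin d, ∑ b : Fin d → Bool with b i = false, δ ^ 2 * (1 / 2) -
          ∑ b : Fin d → Bool, δ ^ 2 * (χ * n) := by
        simp only [Finset.sum_const, nsmul_eq_mul, card_filter_eq_false, Finset.card_univ,
          Fintype.card_fun, Fintype.card_bool, Fintype.card_fin]
        push_cast
        ring
    _ ≤ ∑ i : Fin d, ∑ b : Fin d → Bool with b i = false, δ ^ 2 * (1 / 2) -
          ∑ b : Fin d → Bool, δ ^ 2 * ∑ i with b i = false,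
            T.chiCost (vertexLaw μ ν b) (vertexLaw μ ν (Function.update b i true)) := by
        refine sub_le_sub_left (Finset.sum_le_sum fun b _ => ?_) _
        refine mul_le_mul_of_nonneg_left ?_ (sq_nonneg δ)
        exact (ProtocolTree.sum_chiCost_le _ _ _ hχ.le (hbes b) T).trans
          (mul_le_mul_of_nonneg_left hdepth hχ.le)
    _ = ∑ i : Fin d, ∑ b : Fin d → Bool with b i = false, δ ^ 2 * (1 / 2 -
          T.chiCost (vertexLaw μ ν b) (vertexLaw μ ν (Function.update b i true))) := by
        simp only [mul_sub, Finset.sum_sub_distrib, Finset.mul_sum]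
        congr 1
        simp only [Finset.sum_filter]
        rw [Finset.sum_comm]
    _ ≤ ∑ i : Fin d, ∑ b, T.leafSum (vertexLaw μ ν b)
          (fun y => (e y i - vertex t δ b i) ^ 2) := by
        refine Finset.sum_le_sum fun i _ => ?_
        rw [sum_bool_eq_sum_pairs i]
        refine Finset.sum_le_sum fun b hb => ?_
        exact hpair b i (by simpa using hb)
    _ = ∑ b, T.leafSum (vertexLaw μ ν b) fun y => ‖e y - vertex t δ b‖ ^ 2 := by
        rw [Finset.sum_comm]
        refine Finset.sum_congr rfl fun b _ => ?_
        rw [hnorm, ProtocolTree.leafSum_finset_sum]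

lemma measurable_est_transcript {n k d : ℕ} {Pi : BlackboardProtocol.{u, w} n k 𝓧}
    (T : Estimator Pi d) :
    Measurable fun z : Pi.Seed × (Fin n → 𝓧) => T.est z.1 ((Pi.tree z.1).transcript z.2) := by
  -- There are countably many transcripts, so with the discrete σ-algebra measurability can be
  -- checked one transcript at a time.
  let _ : MeasurableSpace (List Bool) := ⊤
  have h1 : Measurable fun z : Pi.Seed × (Fin n → 𝓧) => (Pi.tree z.1).transcript z.2 :=
    measurable_to_countable' fun y => Pi.measurableSet_transcript y
  have h2 : Measurable fun z : Pi.Seed × List Bool => T.est z.1 z.2 :=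
    measurable_from_prod_countable_left T.measurable_est
  exact h2.comp (measurable_fst.prodMk h1)

lemma risk_eq_lintegral {n k d : ℕ} (Pi : BlackboardProtocol.{u, w} n k 𝓧) (T : Estimator Pi d)
    (μ : Measure 𝓧) [IsProbabilityMeasure μ] (θ : EuclideanSpace ℝ (Fin d)) :
    risk Pi T μ θ = ∫⁻ ω, ∫⁻ x,
      ENNReal.ofReal (‖T.est ω ((Pi.tree ω).transcript x) - θ‖ ^ 2)
        ∂(Measure.pi fun _ : Fin n => μ) ∂Pi.seedLaw := by
  unfold risk
  exact lintegral_prod _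
    (((measurable_est_transcript T).sub_const θ).norm.pow_const 2).ennreal_ofReal.aemeasurable

/-- Lower bound for the Bayes risk of a blackboard protocol with one bit per sensor, when the
parameter is uniformly distributed on the vertices of a cube. -/
theorem sum_risk_ge {n d : ℕ} (Pi : BlackboardProtocol.{u, w} n 1 (Fin d → 𝓧))
    (T : Estimator Pi d) (μ ν : Measure 𝓧) [IsProbabilityMeasure μ]
    [IsProbabilityMeasure ν] (hν : ν ≪ μ) {χ : ℝ} (hχ : 0 < χ)
    (hfχ : ∫⁻ x, ENNReal.ofReal (((ν.rnDeriv μ x).toReal - 1) ^ 2) ∂μ ≤ ENNReal.ofReal χ)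
    (t δ : ℝ) :
    ENNReal.ofReal (2 ^ d * (δ ^ 2 * (d / 4 - n * χ))) ≤
      ∑ b, risk Pi T (vertexLaw μ ν b) (vertex t δ b) := by
  have hpt : ∀ ω b, ∫⁻ x, ENNReal.ofReal (‖T.est ω ((Pi.tree ω).transcript x) - vertex t δ b‖ ^ 2)
      ∂(Measure.pi fun _ : Fin n => vertexLaw μ ν b) =
      ENNReal.ofReal ((Pi.tree ω).leafSum (vertexLaw μ ν b)
        fun y => ‖T.est ω y - vertex t δ b‖ ^ 2) := fun ω b =>
    ProtocolTree.lintegral_transcript (vertexLaw μ ν b) (Pi.tree ω) (Pi.bits_le ω)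
      (fun y => ‖T.est ω y - vertex t δ b‖ ^ 2) fun y => sq_nonneg _
  calc ENNReal.ofReal (2 ^ d * (δ ^ 2 * (d / 4 - n * χ)))
      = ∫⁻ _, ENNReal.ofReal (2 ^ d * (δ ^ 2 * (d / 4 - n * χ))) ∂Pi.seedLaw := by simp
    _ ≤ ∫⁻ ω, ∑ b, ∫⁻ x,
          ENNReal.ofReal (‖T.est ω ((Pi.tree ω).transcript x) - vertex t δ b‖ ^ 2)
          ∂(Measure.pi fun _ : Fin n => vertexLaw μ ν b) ∂Pi.seedLaw := by
        refine lintegral_mono fun ω => ?_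
        simp only [hpt]
        rw [← ENNReal.ofReal_sum_of_nonneg fun b _ =>
          ProtocolTree.leafSum_nonneg _ _ _ fun y => sq_nonneg _]
        exact ENNReal.ofReal_le_ofReal
          (sum_leafSum_ge μ ν hν hχ hfχ t δ (Pi.tree ω) (Pi.bits_le ω) (T.est ω))
    _ = ∑ b, risk Pi T (vertexLaw μ ν b) (vertex t δ b) := by
        simp only [risk_eq_lintegral]
        refine lintegral_finsetSum' _ fun b _ => ?_
        exact ((((measurable_est_transcript T).sub_const
          _).norm.pow_const 2).ennreal_ofReal.lintegral_prod_right').aemeasurable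

end Protocol

/-! ### Scores of the product model and of its factors -/

section Score

variable {𝓧 : Type u} [MeasurableSpace 𝓧]

/-- The remainder in the definition of differentiability in quadratic mean, for a dominated
measure. -/
lemma lintegral_remainder_eq (μ ν μ' : Measure 𝓧) [IsFiniteMeasure μ] [IsFiniteMeasure ν]
    (hμν : μ ≪ ν) {f : 𝓧 → ℝ≥0∞} (hf : Measurable f) (hμ' : μ' = μ.withDensity f)
    {s : 𝓧 → ℝ} (hs : Measurable s) :
    ∫⁻ x, ENNReal.ofReal ((√(μ'.rnDeriv ν x).toReal - √(μ.rnDeriv ν x).toReal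
        - 1 / 2 * s x * √(μ.rnDeriv ν x).toReal) ^ 2) ∂ν =
      ∫⁻ x, ENNReal.ofReal ((√(f x).toReal - 1 - 1 / 2 * s x) ^ 2) ∂μ := by
  set g := μ.rnDeriv ν with hg
  have hgm : Measurable g := Measure.measurable_rnDeriv _ _
  have hμg : μ = ν.withDensity g := (Measure.withDensity_rnDeriv_eq μ ν hμν).symm
  have hμ'g : μ' = ν.withDensity (g * f) := by
    rw [hμ', withDensity_mul ν hgm hf, ← hμg]
  have h1 : μ'.rnDeriv ν =ᵐ[ν] g * f := by
    rw [hμ'g]; exact Measure.rnDeriv_withDensity ν (hgm.mul hf)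
  have hm : Measurable fun x => ENNReal.ofReal ((√(f x).toReal - 1 - 1 / 2 * s x) ^ 2) :=
    (((hf.ennreal_toReal.sqrt.sub_const 1).sub (hs.const_mul _)).pow_const 2).ennreal_ofReal
  rw [← lintegral_rnDeriv_mul hμν hm.aemeasurable]
  refine lintegral_congr_ae ?_
  filter_upwards [h1, Measure.rnDeriv_ne_top μ ν] with x hx hx'
  rw [hx, Pi.mul_apply, ENNReal.toReal_mul, Real.sqrt_mul ENNReal.toReal_nonneg,
    ← hg, show √(g x).toReal * √(f x).toReal - √(g x).toReal - 1 / 2 * s x * √(g x).toReal =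
      √(g x).toReal * (√(f x).toReal - 1 - 1 / 2 * s x) by ring, mul_pow,
    Real.sq_sqrt ENNReal.toReal_nonneg, ENNReal.ofReal_mul ENNReal.toReal_nonneg,
    ENNReal.ofReal_toReal hx']

/-- A score for which the remainder in the definition of differentiability in quadratic mean is
finite is square-integrable. -/
lemma lintegral_sq_lt_top_of_remainder (μ ν μ' : Measure 𝓧) [IsFiniteMeasure μ]
    [IsFiniteMeasure ν] [IsFiniteMeasure μ'] (hμν : μ ≪ ν) {s : 𝓧 → ℝ} (hs : Measurable s)
    (h : ∫⁻ x, ENNReal.ofReal ((√(μ'.rnDeriv ν x).toReal - √(μ.rnDeriv ν x).toReal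
        - 1 / 2 * s x * √(μ.rnDeriv ν x).toReal) ^ 2) ∂ν < ∞) :
    ∫⁻ x, ENNReal.ofReal (s x ^ 2) ∂μ < ∞ := by
  rw [← lintegral_rnDeriv_mul hμν (hs.pow_const 2).ennreal_ofReal.aemeasurable]
  -- With `u`, `v` the roots of the two densities and `w` the remainder, `s u = 2(v - u - w)`, hence
  -- `s² u² ≤ 12(w² + v² + u²)`.
  have hb : ∀ᵐ x ∂ν, μ.rnDeriv ν x * ENNReal.ofReal (s x ^ 2) ≤
      ENNReal.ofReal 12 * (ENNReal.ofReal ((√(μ'.rnDeriv ν x).toReal - √(μ.rnDeriv ν x).toReal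
        - 1 / 2 * s x * √(μ.rnDeriv ν x).toReal) ^ 2) + (μ'.rnDeriv ν x + μ.rnDeriv ν x)) := by
    filter_upwards [Measure.rnDeriv_ne_top μ ν, Measure.rnDeriv_ne_top μ' ν] with x hx hx'
    rw [← ENNReal.ofReal_toReal hx, ← ENNReal.ofReal_toReal hx']
    set a := (μ.rnDeriv ν x).toReal
    set b := (μ'.rnDeriv ν x).toReal
    have ha : 0 ≤ a := ENNReal.toReal_nonneg
    have hb : 0 ≤ b := ENNReal.toReal_nonneg
    rw [ENNReal.toReal_ofReal ha, ENNReal.toReal_ofReal hb, ← ENNReal.ofReal_mul ha,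
      ← ENNReal.ofReal_add hb ha,
      ← ENNReal.ofReal_add (sq_nonneg _) (by positivity), ← ENNReal.ofReal_mul (by norm_num)]
    refine ENNReal.ofReal_le_ofReal ?_
    have h1 := Real.sq_sqrt ha
    have h2 := Real.sq_sqrt hb
    set u := √a
    set v := √b
    rw [← h1, ← h2]
    nlinarith [sq_nonneg (v - u - 1 / 2 * s x * u + v), sq_nonneg (v - u - 1 / 2 * s x * u - u),
      sq_nonneg (u + v)]
  refine (lintegral_mono_ae hb).trans_lt ?_
  rw [lintegral_const_mul' _ _ ENNReal.ofReal_ne_top]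
  refine ENNReal.mul_lt_top ENNReal.ofReal_lt_top ?_
  have hm : Measurable fun x => μ'.rnDeriv ν x + μ.rnDeriv ν x :=
    (Measure.measurable_rnDeriv _ _).add (Measure.measurable_rnDeriv _ _)
  rw [lintegral_add_right _ hm, lintegral_add_right _ (Measure.measurable_rnDeriv _ _)]
  exact ENNReal.add_lt_top.2 ⟨h, ENNReal.add_lt_top.2
    ⟨Measure.lintegral_rnDeriv_lt_top _ _, Measure.lintegral_rnDeriv_lt_top _ _⟩⟩

variable {d : ℕ}

lemma inner_single (v : EuclideanSpace ℝ (Fin d)) (i : Fin d) (r : ℝ) :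
    inner ℝ v (EuclideanSpace.single i r) = r * v i := by
  simp [EuclideanSpace.inner_single_right]

lemma tendsto_add_single (θ₀ : EuclideanSpace ℝ (Fin d)) (i : Fin d) :
    Tendsto (fun r : ℝ => θ₀ + EuclideanSpace.single i r) (𝓝[>] 0) (𝓝 θ₀) := by
  have hc : Continuous fun r : ℝ => θ₀ + EuclideanSpace.single i r := by
    refine continuous_const.add ?_
    exact (PiLp.continuous_toLp 2 fun _ : Fin d => ℝ).comp
      (continuous_single (A := fun _ : Fin d => ℝ) i)
  have := hc.tendsto 0
  rw [(by simp : EuclideanSpace.single i (0 : ℝ) = 0), add_zero] at this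
  exact this.mono_left nhdsWithin_le_nhds

lemma productModel_add_single (p : ℝ → Measure 𝓧) (t₀ r : ℝ) (i : Fin d) :
    productModel p ((WithLp.toLp 2 fun _ => t₀) + EuclideanSpace.single i r) =
      Measure.pi (Function.update (fun _ => p t₀) i (p (t₀ + r))) := by
  unfold productModel
  congr 1
  funext j
  rcases eq_or_ne j i with rfl | hj
  · simp
  · simp [hj]

lemma isProbabilityMeasure_productModel {p : ℝ → Measure 𝓧} {θ : EuclideanSpace ℝ (Fin d)}
    (h : ∀ i, IsProbabilityMeasure (p (θ i))) : IsProbabilityMeasure (productModel p θ) := by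
  unfold productModel; infer_instance

/-- The score of a product model is square-integrable. -/
lemma lintegral_score_sq_lt_top {p : ℝ → Measure 𝓧} {Θ : Set (EuclideanSpace ℝ (Fin d))} {t₀ : ℝ}
    {S : (Fin d → 𝓧) → EuclideanSpace ℝ (Fin d)}
    (hp : ∀ θ ∈ Θ, ∀ i, IsProbabilityMeasure (p (θ i)))
    (hΘ : (WithLp.toLp 2 fun _ => t₀) ∈ interior Θ)
    (hS : DiffQuadMean (productModel p) (WithLp.toLp 2 fun _ => t₀) S) (i : Fin d) :
    ∫⁻ x, ENNReal.ofReal (S x i ^ 2) ∂(productModel p (WithLp.toLp 2 fun _ => t₀)) < ∞ := by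
  set θ₀ : EuclideanSpace ℝ (Fin d) := WithLp.toLp 2 fun _ => t₀ with hθ₀
  have hev := (tendsto_add_single θ₀ i).eventually
    ((hS.remainder 1 one_pos).and (mem_interior_iff_mem_nhds.1 hΘ))
  obtain ⟨r, ⟨hr, hrΘ⟩, hr0⟩ := (hev.and self_mem_nhdsWithin).exists
  have := isProbabilityMeasure_productModel (hp _ hrΘ)
  have := isProbabilityMeasure_productModel (hp _ (interior_subset hΘ))
  have hSi : Measurable fun x => S x i := by
    have := hS.measurable_score
    fun_prop
  simp only [add_sub_cancel_left, inner_single] at hr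
  -- This argument needs no absolute continuity, which is known only once the threshold of the
  -- likelihood condition is shown to be positive; that positivity relies on the present bound.
  have h := lintegral_sq_lt_top_of_remainder (productModel p θ₀) _
    (productModel p (θ₀ + EuclideanSpace.single i r))
    (Measure.le_add_left le_rfl).absolutelyContinuous
    (hSi.const_mul r) (hr.trans_lt ENNReal.ofReal_lt_top)
  simp only [mul_pow, ENNReal.ofReal_mul (sq_nonneg r)] at h
  rw [lintegral_const_mul' _ _ ENNReal.ofReal_ne_top] at h
  by_contra hc
  rw [not_lt, top_le_iff] at hc
  have hr2 : 0 < r ^ 2 := pow_pos hr0 2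
  rw [hc, ENNReal.mul_top (ENNReal.ofReal_pos.2 hr2).ne'] at h
  exact lt_irrefl _ h

/-- The components of the score of a product model are the scores of its factors. -/
lemma score_ae_eq {p : ℝ → Measure 𝓧} {t₀ : ℝ}
    {S : (Fin d → 𝓧) → EuclideanSpace ℝ (Fin d)} {s₀ : 𝓧 → ℝ} [IsProbabilityMeasure (p t₀)]
    (hp : ∀ᶠ r in 𝓝[>] (0 : ℝ), IsProbabilityMeasure (p (t₀ + r)) ∧ p (t₀ + r) ≪ p t₀)
    (hS : DiffQuadMean (productModel p) (WithLp.toLp 2 fun _ => t₀) S)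
    (hs : DiffQuadMean p t₀ s₀) (i : Fin d) :
    (fun x => S x i) =ᵐ[Measure.pi fun _ => p t₀] fun x => s₀ (x i) := by
  set θ₀ : EuclideanSpace ℝ (Fin d) := WithLp.toLp 2 fun _ => t₀ with hθ₀
  set P : Measure (Fin d → 𝓧) := Measure.pi fun _ => p t₀ with hP
  have hSi : Measurable fun x => S x i := by
    have := hS.measurable_score
    fun_prop
  have hsm : Measurable s₀ := hs.measurable_score
  have hsi : Measurable fun x : Fin d → 𝓧 => s₀ (x i) := hsm.comp (measurable_pi_apply i)
  -- Along the `i`-th axis, `√f(x_i) - 1` is within `ε r²`, in squared `L²` distance, of both `r S_i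
  -- / 2` and `r s₀(x_i) / 2`. Subtracting gives `(8 / r²)(ε r² + ε r²) = 16 ε`.
  have hbound : ∀ ε : ℝ, 0 < ε →
      ∫⁻ x, ENNReal.ofReal ((S x i - s₀ (x i)) ^ 2) ∂P ≤ ENNReal.ofReal (16 * ε) := by
    intro ε hε
    have ht : Tendsto (fun r : ℝ => t₀ + r) (𝓝[>] 0) (𝓝 t₀) := by
      have : Tendsto (fun r : ℝ => t₀ + r) (𝓝 0) (𝓝 (t₀ + 0)) := tendsto_const_nhds.add tendsto_id
      rw [add_zero] at this
      exact this.mono_left nhdsWithin_le_nhds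
    obtain ⟨r, ⟨⟨⟨hpr, hac⟩, hr1⟩, hr2⟩, hr0⟩ := (((hp.and ((tendsto_add_single θ₀ i).eventually
      (hS.remainder ε hε))).and (ht.eventually (hs.remainder ε hε))).and self_mem_nhdsWithin).exists
    have hr0 : 0 < r := hr0
    set f := (p (t₀ + r)).rnDeriv (p t₀) with hf
    have hfm : Measurable f := Measure.measurable_rnDeriv _ _
    have e0 : productModel p θ₀ = P := rfl
    have e1 : productModel p (θ₀ + EuclideanSpace.single i r) = P.withDensity fun x => f (x i) := by
      rw [hθ₀, productModel_add_single, pi_update_eq_withDensity _ i _ hac]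
    have hprob : IsProbabilityMeasure (productModel p (θ₀ + EuclideanSpace.single i r)) := by
      rw [hθ₀, productModel_add_single]
      have := isProbabilityMeasure_update (fun _ : Fin d => p t₀) i (p (t₀ + r))
      infer_instance
    simp only [add_sub_cancel_left, inner_single, e0] at hr1
    rw [lintegral_remainder_eq P _ _ (Measure.le_add_left le_rfl).absolutelyContinuous
      (hfm.comp (measurable_pi_apply i)) e1 (hSi.const_mul r)] at hr1
    have e2 : ∀ x, inner ℝ (s₀ x) (t₀ + r - t₀) = r * s₀ x := by
      intro x; simp
    simp only [e2] at hr2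
    rw [lintegral_remainder_eq (p t₀) _ _ (Measure.le_add_left le_rfl).absolutelyContinuous
      hfm (Measure.withDensity_rnDeriv_eq _ _ hac).symm (hsm.const_mul r)] at hr2
    have hm2 : Measurable fun x => ENNReal.ofReal ((√(f x).toReal - 1 - 1 / 2 * (r * s₀ x)) ^ 2) :=
      (((hfm.ennreal_toReal.sqrt.sub_const 1).sub
        ((hsm.const_mul r).const_mul _)).pow_const 2).ennreal_ofReal
    rw [← (measurePreserving_eval (fun _ : Fin d => p t₀) i).lintegral_comp hm2] at hr2
    have hm2' : Measurable fun x : Fin d → 𝓧 =>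
        ENNReal.ofReal ((√(f (x i)).toReal - 1 - 1 / 2 * (r * s₀ (x i))) ^ 2) :=
      hm2.comp (measurable_pi_apply i)
    have hn1 : ‖EuclideanSpace.single i r‖ ^ 2 = r ^ 2 := by simp
    have hn2 : ‖t₀ + r - t₀‖ ^ 2 = r ^ 2 := by simp
    rw [hn1] at hr1
    rw [hn2] at hr2
    have hpt : ∀ x : Fin d → 𝓧, ENNReal.ofReal ((S x i - s₀ (x i)) ^ 2) ≤
        ENNReal.ofReal (8 / r ^ 2) *
          (ENNReal.ofReal ((√(f (x i)).toReal - 1 - 1 / 2 * (r * S x i)) ^ 2) +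
          ENNReal.ofReal ((√(f (x i)).toReal - 1 - 1 / 2 * (r * s₀ (x i))) ^ 2)) := by
      intro x
      rw [← ENNReal.ofReal_add (sq_nonneg _) (sq_nonneg _), ← ENNReal.ofReal_mul (by positivity)]
      refine ENNReal.ofReal_le_ofReal ?_
      set F := √(f (x i)).toReal
      have h8 : (S x i - s₀ (x i)) ^ 2 = 4 / r ^ 2 * ((F - 1 - 1 / 2 * (r * s₀ (x i))) -
        (F - 1 - 1 / 2 * (r * S x i))) ^ 2 := by field_simp; ring
      rw [h8, show 8 / r ^ 2 = 4 / r ^ 2 * 2 by ring, mul_assoc]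
      refine mul_le_mul_of_nonneg_left ?_ (by positivity)
      nlinarith [sq_nonneg ((F - 1 - 1 / 2 * (r * s₀ (x i))) + (F - 1 - 1 / 2 * (r * S x i)))]
    refine (lintegral_mono hpt).trans ?_
    rw [lintegral_const_mul' _ _ ENNReal.ofReal_ne_top,
      lintegral_add_right _ hm2']
    refine (mul_le_mul_right (add_le_add hr1 hr2) _).trans ?_
    rw [← ENNReal.ofReal_add (by positivity) (by positivity), ← ENNReal.ofReal_mul (by positivity)]
    refine ENNReal.ofReal_le_ofReal (le_of_eq ?_)
    field_simp
    ring
  have hzero : ∫⁻ x, ENNReal.ofReal ((S x i - s₀ (x i)) ^ 2) ∂P = 0 := by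
    have htop := ((hbound 1 one_pos).trans_lt ENNReal.ofReal_lt_top).ne
    rw [← ENNReal.ofReal_toReal htop] at hbound ⊢
    rw [ENNReal.ofReal_eq_zero]
    by_contra! hc
    have h := hbound (_ / 32) (by positivity)
    rw [ENNReal.ofReal_le_ofReal_iff (by positivity)] at h
    linarith
  have hm : Measurable fun x => ENNReal.ofReal ((S x i - s₀ (x i)) ^ 2) :=
    ((hSi.sub hsi).pow_const 2).ennreal_ofReal
  rw [lintegral_eq_zero_iff hm] at hzero
  filter_upwards [hzero] with x hx
  have : (S x i - s₀ (x i)) ^ 2 ≤ 0 := by simpa using hx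
  have := pow_eq_zero_iff two_ne_zero |>.1 (le_antisymm this (sq_nonneg _))
  linarith

end Score

/-! ### From the likelihood condition to a χ² bound -/

section ChiSquare

/-- The Cauchy–Schwarz inequality for real square-integrable functions. -/
lemma sq_integral_mul_le {α : Type*} [MeasurableSpace α] {μ : Measure α} {f g : α → ℝ}
    (hf : MemLp f 2 μ) (hg : MemLp g 2 μ) :
    (∫ x, f x * g x ∂μ) ^ 2 ≤ (∫ x, f x ^ 2 ∂μ) * ∫ x, g x ^ 2 ∂μ := by
  have hfg : Integrable (fun x => f x * g x) μ := hf.integrable_mul hg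
  have h : ∀ t : ℝ, 0 ≤ (∫ x, g x ^ 2 ∂μ) * (t * t) + (2 * ∫ x, f x * g x ∂μ) * t +
      ∫ x, f x ^ 2 ∂μ := by
    intro t
    have e : ∫ x, (f x + t * g x) ^ 2 ∂μ = (∫ x, g x ^ 2 ∂μ) * (t * t) +
        (2 * ∫ x, f x * g x ∂μ) * t + ∫ x, f x ^ 2 ∂μ := by
      have e1 : ∀ x, (f x + t * g x) ^ 2 = (t * t) * g x ^ 2 + (2 * t) * (f x * g x) + f x ^ 2 :=
        fun x => by ring
      simp only [e1]
      have h1 : Integrable (fun x => t * t * g x ^ 2 + 2 * t * (f x * g x)) μ :=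
        (hg.integrable_sq.const_mul _).add (hfg.const_mul _)
      rw [integral_add h1 hf.integrable_sq,
        integral_add (hg.integrable_sq.const_mul _) (hfg.const_mul _), integral_const_mul,
        integral_const_mul]
      ring
    rw [← e]
    exact integral_nonneg fun x => sq_nonneg _
  have := discrim_le_zero h
  rw [discrim] at this
  linarith

/-- Pairing `u` with `-u`: the sum `φ (u i) + φ (-(u i))` does not depend on `u`. -/
lemma sum_units_apply {d : ℕ} (i : Fin d) (φ : ℤˣ → ℝ) :
    ∑ u : Fin d → ℤˣ, φ (u i) = 2 ^ d * ((φ 1 + φ (-1)) / 2) := by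
  have h1 : ∑ u : Fin d → ℤˣ, φ (u i) = ∑ u : Fin d → ℤˣ, φ (-(u i)) :=
    (Equiv.sum_comp (Equiv.neg (Fin d → ℤˣ)) fun u => φ (u i)).symm
  have h2 : ∀ e : ℤˣ, φ e + φ (-e) = φ 1 + φ (-1) := by
    intro e
    rcases Int.units_eq_one_or e with rfl | rfl
    · rfl
    · rw [neg_neg, add_comm]
  have h3 : ∑ u : Fin d → ℤˣ, φ (u i) + ∑ u : Fin d → ℤˣ, φ (-(u i)) =
      2 ^ d * (φ 1 + φ (-1)) := by
    rw [← Finset.sum_add_distrib]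
    simp [h2, mul_add]
  linarith

variable {𝓧 : Type u} [MeasurableSpace 𝓧] {d : ℕ}

lemma productModel_signVec (p : ℝ → Measure 𝓧) (t₀ δ : ℝ) (u : Fin d → ℤˣ) :
    productModel p ((WithLp.toLp 2 fun _ => t₀) + δ • signVec u) =
      Measure.pi fun i => p (t₀ + δ * ((u i : ℤ) : ℝ)) := by
  unfold productModel signVec
  simp

/-- Testing the second-moment condition on the likelihood ratios against a function of one
coordinate. -/
lemma sq_integral_le_of_likelihoodKernel (p : ℝ → Measure 𝓧) {t₀ δ N : ℝ}
    {S : (Fin d → 𝓧) → EuclideanSpace ℝ (Fin d)} {s₀ : 𝓧 → ℝ} (hS : Measurable S)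
    [IsProbabilityMeasure (p t₀)]
    (hp : ∀ e : ℤˣ, IsProbabilityMeasure (p (t₀ + δ * ((e : ℤ) : ℝ)))) (hs₀ : MemLp s₀ 2 (p t₀))
    (hSs : ∀ i, (fun x => S x i) =ᵐ[Measure.pi fun _ => p t₀] fun x => s₀ (x i))
    (hac : ∀ u : Fin d → ℤˣ, productModel p ((WithLp.toLp 2 fun _ => t₀) + δ • signVec u) ≪
      productModel p (WithLp.toLp 2 fun _ => t₀))
    (hN : 0 ≤ N)
    (hR : ∫⁻ z : (Fin d → 𝓧) × (Fin d → 𝓧), ENNReal.ofReal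
        ((likelihoodKernel (productModel p) (WithLp.toLp 2 fun _ => t₀) δ z.1 z.2
          - δ ^ 2 * inner ℝ (S z.1) (S z.2)) ^ 2)
      ∂((productModel p (WithLp.toLp 2 fun _ => t₀)).prod
        (productModel p (WithLp.toLp 2 fun _ => t₀))) ≤ ENNReal.ofReal (N ^ 2))
    (i₀ : Fin d) {g : 𝓧 → ℝ} (hg : Measurable g) {c : ℝ} (hgc : ∀ x, ‖g x‖ ≤ c)
    (hg0 : ∫ x, g x ∂(p t₀) = 0) :
    (∫ x, g x ∂(p (t₀ + δ))) ^ 2 / 2 ≤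
      (∫ x, g x ^ 2 ∂(p t₀)) * (δ ^ 2 * ∫ x, s₀ x ^ 2 ∂(p t₀) + N) := by
  set θ₀ : EuclideanSpace ℝ (Fin d) := WithLp.toLp 2 fun _ => t₀ with hθ₀
  have hPdef : productModel p θ₀ = Measure.pi fun _ => p t₀ := rfl
  rw [hPdef] at hR hac
  set P : Measure (Fin d → 𝓧) := Measure.pi fun _ => p t₀ with hP
  set G : (Fin d → 𝓧) → ℝ := fun x => g (x i₀) with hG
  have hGm : Measurable G := hg.comp (measurable_pi_apply i₀)
  have hGc : ∀ x, ‖G x‖ ≤ c := fun x => hgc _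
  have hGi : Integrable G P := Integrable.of_bound hGm.aestronglyMeasurable c (ae_of_all _ hGc)
  have hG0 : ∫ x, G x ∂P = 0 := by
    rw [← hg0]
    exact integral_comp_eval (μ := fun _ : Fin d => p t₀) hg.aestronglyMeasurable
  have hG2 : ∫ x, G x ^ 2 ∂P = ∫ x, g x ^ 2 ∂(p t₀) :=
    integral_comp_eval (μ := fun _ : Fin d => p t₀) (hg.pow_const 2).aestronglyMeasurable
  set V := ∫ x, g x ^ 2 ∂(p t₀) with hV
  have hV0 : 0 ≤ V := integral_nonneg fun x => sq_nonneg _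
  set L : (Fin d → ℤˣ) → (Fin d → 𝓧) → ℝ := fun u x =>
    ((productModel p (θ₀ + δ • signVec u)).rnDeriv P x).toReal - 1 with hL
  have hLm : ∀ u, Measurable (L u) := fun u =>
    (Measure.measurable_rnDeriv _ _).ennreal_toReal.sub_const 1
  have hPu : ∀ u, IsProbabilityMeasure (productModel p (θ₀ + δ • signVec u)) := by
    intro u
    rw [hθ₀, productModel_signVec]
    have := fun i => hp (u i)
    infer_instance
  have hLG : ∀ u, Integrable (fun x => L u x * G x) P ∧
      ∫ x, L u x * G x ∂P = ∫ x, g x ∂(p (t₀ + δ * ((u i₀ : ℤ) : ℝ))) := by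
    intro u
    have h1 : Integrable (fun x => ((productModel p (θ₀ + δ • signVec u)).rnDeriv P x).toReal * G x)
        P := by
      rw [integrable_toReal_rnDeriv_mul_iff (hac u)]
      exact Integrable.of_bound hGm.aestronglyMeasurable c (ae_of_all _ hGc)
    simp only [hL, sub_mul, one_mul]
    refine ⟨h1.sub hGi, ?_⟩
    have := fun i => hp (u i)
    rw [integral_sub h1 hGi, hG0, sub_zero, integral_toReal_rnDeriv_mul (hac u), hθ₀,
      productModel_signVec]
    exact integral_comp_eval (μ := fun i => p (t₀ + δ * ((u i : ℤ) : ℝ))) hg.aestronglyMeasurable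
  -- Against this tensor test function the likelihood kernel integrates to an average of squares,
  -- and the score kernel keeps only its coordinate `i₀`, the others vanishing by independence and
  -- centring.
  set W : (Fin d → 𝓧) × (Fin d → 𝓧) → ℝ := fun z => G z.1 * G z.2 with hW
  set K : (Fin d → 𝓧) × (Fin d → 𝓧) → ℝ := fun z =>
    likelihoodKernel (productModel p) θ₀ δ z.1 z.2 with hK
  have hKW : ∀ z, K z * W z = ((2 : ℝ) ^ d)⁻¹ * ∑ u, (L u z.1 * G z.1) * (L u z.2 * G z.2) := by
    intro z
    simp only [hK, hW, likelihoodKernel, hL, hPdef]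
    rw [mul_assoc, Finset.sum_mul]
    congr 1
    refine Finset.sum_congr rfl fun u _ => ?_
    ring
  have hKWi : Integrable (fun z => K z * W z) (P.prod P) := by
    simp only [hKW]
    exact (integrable_finsetSum _ fun u _ => (hLG u).1.mul_prod (hLG u).1).const_mul _
  have hKWe : ∫ z, K z * W z ∂(P.prod P) =
      ((∫ x, g x ∂(p (t₀ + δ))) ^ 2 + (∫ x, g x ∂(p (t₀ - δ))) ^ 2) / 2 := by
    simp only [hKW]
    rw [integral_const_mul, integral_finsetSum _ fun u _ => (hLG u).1.mul_prod (hLG u).1]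
    have : ∀ u : Fin d → ℤˣ, ∫ z : (Fin d → 𝓧) × (Fin d → 𝓧),
        L u z.1 * G z.1 * (L u z.2 * G z.2) ∂(P.prod P) =
        (fun e : ℤˣ => (∫ x, g x ∂(p (t₀ + δ * ((e : ℤ) : ℝ)))) ^ 2) (u i₀) := by
      intro u
      rw [integral_prod_mul (fun x => L u x * G x) (fun x => L u x * G x), (hLG u).2]
      exact (sq _).symm
    rw [Finset.sum_congr rfl fun u _ => this u,
      sum_units_apply i₀ fun e : ℤˣ => (∫ x, g x ∂(p (t₀ + δ * ((e : ℤ) : ℝ)))) ^ 2,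
      inv_mul_cancel_left₀ (by positivity)]
    simp [sub_eq_add_neg]
  have hSi : ∀ i, Integrable (fun x => S x i * G x) P ∧ ∫ x, S x i * G x ∂P =
      if i = i₀ then ∫ x, s₀ x * g x ∂(p t₀) else 0 := by
    intro i
    have hae : (fun x => S x i * G x) =ᵐ[P] fun x => s₀ (x i) * G x := by
      filter_upwards [hSs i] with x hx
      rw [hx]
    have hsi : Integrable (fun x : Fin d → 𝓧 => s₀ (x i)) P :=
      integrable_comp_eval (μ := fun _ : Fin d => p t₀) (hs₀.integrable one_le_two)
    refine ⟨(hsi.mul_bdd hGm.aestronglyMeasurable (ae_of_all _ hGc)).congr hae.symm, ?_⟩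
    rw [integral_congr_ae hae]
    split_ifs with hi
    · subst hi
      exact integral_comp_eval (μ := fun _ : Fin d => p t₀) (f := fun x => s₀ x * g x)
        (hs₀.aestronglyMeasurable.mul hg.aestronglyMeasurable)
    · have hind := (ProbabilityTheory.iIndepFun_pi (μ := fun _ : Fin d => p t₀)
        (X := fun j x => if j = i then s₀ x else g x) (fun j => by
          split_ifs
          · exact hs₀.aestronglyMeasurable.aemeasurable
          · exact hg.aemeasurable)).indepFun hi
      simp only [if_true, if_neg (Ne.symm hi)] at hind
      rw [hind.integral_fun_mul_eq_mul_integral hsi.aestronglyMeasurable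
        hGm.aestronglyMeasurable, hG0, mul_zero]
  have hIW : ∀ z : (Fin d → 𝓧) × (Fin d → 𝓧), δ ^ 2 * inner ℝ (S z.1) (S z.2) * W z =
      δ ^ 2 * ∑ i, (S z.1 i * G z.1) * (S z.2 i * G z.2) := by
    intro z
    rw [PiLp.inner_apply, mul_assoc, Finset.sum_mul]
    congr 1
    refine Finset.sum_congr rfl fun i _ => ?_
    simp only [hW, RCLike.inner_apply, conj_trivial]
    ring
  have hIWi : Integrable (fun z : (Fin d → 𝓧) × (Fin d → 𝓧) =>
      δ ^ 2 * inner ℝ (S z.1) (S z.2) * W z) (P.prod P) := by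
    simp only [hIW]
    exact (integrable_finsetSum _ fun i _ => (hSi i).1.mul_prod (hSi i).1).const_mul _
  have hIWe : ∫ z, δ ^ 2 * inner ℝ (S z.1) (S z.2) * W z ∂(P.prod P) =
      δ ^ 2 * (∫ x, s₀ x * g x ∂(p t₀)) ^ 2 := by
    simp only [hIW]
    rw [integral_const_mul, integral_finsetSum _ fun i _ => (hSi i).1.mul_prod (hSi i).1]
    congr 1
    rw [Finset.sum_congr rfl fun i _ =>
      integral_prod_mul (fun x => S x i * G x) (fun x => S x i * G x)]
    simp only [(hSi _).2]
    simp [sq]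
  have hgL : MemLp g 2 (p t₀) := MemLp.of_bound hg.aestronglyMeasurable c (ae_of_all _ hgc)
  have hGL : MemLp G 2 P := MemLp.of_bound hGm.aestronglyMeasurable c (ae_of_all _ hGc)
  have hCS := sq_integral_mul_le hs₀ hgL
  set R : (Fin d → 𝓧) × (Fin d → 𝓧) → ℝ := fun z =>
    K z - δ ^ 2 * inner ℝ (S z.1) (S z.2) with hRdef
  have hRm : Measurable R := by
    have h1 : Measurable K := by
      simp only [hK, likelihoodKernel]
      refine (Finset.measurable_fun_sum _ fun u _ => ?_).const_mul _
      exact ((hLm u).comp measurable_fst).mul ((hLm u).comp measurable_snd)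
    exact h1.sub (((hS.comp measurable_fst).inner (hS.comp measurable_snd)).const_mul _)
  have hRL : MemLp R 2 (P.prod P) := memLp_two_of_lintegral_sq_lt_top hRm.aestronglyMeasurable
    (hR.trans_lt ENNReal.ofReal_lt_top)
  have hR2 : ∫ z, R z ^ 2 ∂(P.prod P) ≤ N ^ 2 := by
    rw [integral_eq_lintegral_of_nonneg_ae (ae_of_all _ fun x => sq_nonneg _)
      (hRm.pow_const 2).aestronglyMeasurable]
    exact ENNReal.toReal_le_of_le_ofReal (sq_nonneg _) hR
  have hWL : MemLp W 2 (P.prod P) := by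
    refine MemLp.of_bound ((hGm.comp measurable_fst).mul
      (hGm.comp measurable_snd)).aestronglyMeasurable (c * c) (ae_of_all _ fun z => ?_)
    rw [norm_mul]
    exact mul_le_mul (hGc _) (hGc _) (norm_nonneg _) ((norm_nonneg _).trans (hGc z.1))
  have hW2 : ∫ z, W z ^ 2 ∂(P.prod P) = V ^ 2 := by
    simp only [hW, mul_pow]
    rw [integral_prod_mul (fun x => G x ^ 2) (fun x => G x ^ 2), hG2, sq]
  have hRW : ∫ z, R z * W z ∂(P.prod P) ≤ N * V := by
    have h1 := sq_integral_mul_le hRL hWL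
    rw [hW2] at h1
    refine le_of_sq_le_sq ?_ (mul_nonneg hN hV0)
    rw [mul_pow]
    exact h1.trans (mul_le_mul_of_nonneg_right hR2 (sq_nonneg _))
  have hsub : ∫ z, R z * W z ∂(P.prod P) = ∫ z, K z * W z ∂(P.prod P) -
      ∫ z, δ ^ 2 * inner ℝ (S z.1) (S z.2) * W z ∂(P.prod P) := by
    rw [← integral_sub hKWi hIWi]
    simp only [hRdef, sub_mul]
  rw [hKWe, hIWe] at hsub
  have h1 := mul_le_mul_of_nonneg_left hCS (sq_nonneg δ)
  -- The square at `t₀ - δ` is discarded, which is why the conclusion has a factor `1/2`.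
  have h2 := sq_nonneg (∫ x, g x ∂(p (t₀ - δ)))
  nlinarith [h1, h2, hRW, hsub]

/-- If the integrals of bounded centred functions under `ν` satisfy a bound by their second
moments under `μ`, then the `χ²`-divergence of `ν` from `μ` is bounded. -/
lemma chiSq_le_of_test_functions (μ ν : Measure 𝓧) [IsProbabilityMeasure μ]
    [IsProbabilityMeasure ν] (hνμ : ν ≪ μ) {M : ℝ} (hM : 0 ≤ M)
    (h : ∀ (g : 𝓧 → ℝ) (c : ℝ), Measurable g → (∀ x, ‖g x‖ ≤ c) → ∫ x, g x ∂μ = 0 →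
      (∫ x, g x ∂ν) ^ 2 / 2 ≤ (∫ x, g x ^ 2 ∂μ) * M) :
    ∫⁻ x, ENNReal.ofReal (((ν.rnDeriv μ x).toReal - 1) ^ 2) ∂μ ≤ ENNReal.ofReal (2 * M) := by
  set f : 𝓧 → ℝ := fun x => (ν.rnDeriv μ x).toReal with hf
  have hfm : Measurable f := (Measure.measurable_rnDeriv _ _).ennreal_toReal
  have hf0 : ∀ x, 0 ≤ f x := fun x => ENNReal.toReal_nonneg
  have hfi : Integrable f μ := Measure.integrable_toReal_rnDeriv
  have hf1 : ∫ x, f x ∂μ = 1 := by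
    rw [hf, Measure.integral_toReal_rnDeriv hνμ]; simp
  -- The optimal test function `f - 1` need not be bounded or known to be square-integrable, so it
  -- is truncated; the bound is uniform in `k` and passes to the limit by monotone convergence.
  set A : ℕ → Set 𝓧 := fun k => {x | f x ≤ k} with hA
  have hAm : ∀ k, MeasurableSet (A k) := fun k => measurableSet_le hfm measurable_const
  have hdir : Directed (fun s t => s ⊆ t) A := by
    refine Monotone.directed_le fun k l hkl x hx => ?_
    exact le_trans (show f x ≤ k from hx) (by exact_mod_cast hkl)
  have hU : ⋃ k, A k = Set.univ := by
    ext x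
    simpa only [Set.mem_iUnion, Set.mem_univ, iff_true] using! exists_nat_ge (f x)
  rw [← setLIntegral_univ, ← hU, setLIntegral_iUnion_of_directed _ hdir]
  refine iSup_le fun k => ?_
  rw [← lintegral_indicator (hAm k)]
  set q : 𝓧 → ℝ := (A k).indicator fun x => f x - 1 with hq
  have hqm : Measurable q := (hfm.sub_const 1).indicator (hAm k)
  have hqc : ∀ x, ‖q x‖ ≤ k + 1 := by
    intro x
    by_cases hx : x ∈ A k
    · have hx' : f x ≤ k := hx
      rw [hq, Set.indicator_of_mem hx, Real.norm_eq_abs, abs_le]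
      constructor <;> linarith [hf0 x, (Nat.cast_nonneg k : (0 : ℝ) ≤ k)]
    · rw [hq, Set.indicator_of_notMem hx, norm_zero]
      positivity
  have hqL : MemLp q 2 μ := MemLp.of_bound hqm.aestronglyMeasurable _ (ae_of_all _ hqc)
  have hqi : Integrable q μ := hqL.integrable one_le_two
  have hq2 : ∀ x, (A k).indicator (fun x => ENNReal.ofReal ((f x - 1) ^ 2)) x =
      ENNReal.ofReal (q x ^ 2) := by
    intro x
    by_cases hx : x ∈ A k <;> simp [hq, hx]
  rw [lintegral_congr hq2, ← ofReal_integral_eq_lintegral_ofReal hqL.integrable_sq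
    (ae_of_all _ fun x => sq_nonneg _)]
  refine ENNReal.ofReal_le_ofReal ?_
  set J := ∫ x, q x ^ 2 ∂μ with hJ
  set m := ∫ x, q x ∂μ with hm
  rcases le_or_gt J 0 with hJ0 | hJ0
  · linarith
  have hgi : ∫ x, (q x - m) ∂μ = 0 := by
    rw [integral_sub hqi (integrable_const _)]; simp [hm]
  have hg2 : ∫ x, (q x - m) ^ 2 ∂μ ≤ J := by
    have e : ∀ x, (q x - m) ^ 2 = q x ^ 2 - (2 * m) * q x + m ^ 2 := fun x => by ring
    simp only [e]
    have h1 : Integrable (fun x => q x ^ 2 - 2 * m * q x) μ :=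
      hqL.integrable_sq.sub (hqi.const_mul _)
    rw [integral_add h1 (integrable_const _),
      integral_sub hqL.integrable_sq (hqi.const_mul _), integral_const_mul, ← hm, ← hJ]
    simp only [integral_const, probReal_univ, one_smul]
    nlinarith [sq_nonneg m]
  -- Since `q` is `f - 1` or `0`, `f q = q² + q`; the terms `∫ q = m` and `m ∫ f = m` cancel. Then
  -- `J² / 2 ≤ J M`, and `J` can be divided out.
  have hgν : ∫ x, (q x - m) ∂ν = J := by
    rw [← integral_toReal_rnDeriv_mul hνμ]
    have e : ∀ x, (ν.rnDeriv μ x).toReal * (q x - m) = q x ^ 2 + (q x - m * f x) := by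
      intro x
      have : f x * q x = q x ^ 2 + q x := by
        by_cases hx : x ∈ A k
        · simp only [hq, Set.indicator_of_mem hx]; ring
        · simp [hq, hx]
      change f x * (q x - m) = _
      linarith
    simp only [e]
    have h1 : Integrable (fun x => q x - m * f x) μ := hqi.sub (hfi.const_mul _)
    rw [integral_add hqL.integrable_sq h1,
      integral_sub hqi (hfi.const_mul _), integral_const_mul, hf1, ← hm]
    simp [hJ]
  have h1 := h (fun x => q x - m) (k + 1 + ‖m‖) (hqm.sub_const m)
    (fun x => (norm_sub_le _ _).trans (add_le_add_left (hqc x) _)) hgi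
  rw [hgν] at h1
  have h2 := h1.trans (mul_le_mul_of_nonneg_right hg2 hM)
  nlinarith

end ChiSquare

/-! ### Nondegeneracy, cubes and numerical estimates -/

section Minimax

variable {𝓧 : Type u} [MeasurableSpace 𝓧] {d : ℕ}

lemma maxDiagFisher_eq_fisherInfo [Nonempty (Fin d)] {μ : Measure 𝓧} [IsProbabilityMeasure μ]
    {S : (Fin d → 𝓧) → EuclideanSpace ℝ (Fin d)} {s₀ : 𝓧 → ℝ} (hs₀ : Measurable s₀)
    (h : ∀ i, (fun x => S x i) =ᵐ[Measure.pi fun _ => μ] fun x => s₀ (x i)) :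
    maxDiagFisher (Measure.pi fun _ => μ) S = fisherInfo μ s₀ := by
  have hi : ∀ i, fisherMatrix (Measure.pi fun _ => μ) S i i = fisherInfo μ s₀ := by
    intro i
    have e : (fun x => S x i * S x i) =ᵐ[Measure.pi fun _ => μ] fun x => s₀ (x i) ^ 2 := by
      filter_upwards [h i] with x hx
      rw [hx, sq]
    simp only [fisherMatrix, Matrix.of_apply, fisherInfo]
    rw [integral_congr_ae e]
    exact integral_comp_eval (μ := fun _ : Fin d => μ) (hs₀.pow_const 2).aestronglyMeasurable
  simp only [maxDiagFisher, hi, ciSup_const]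

/-- A vanishing diagonal entry would make `S x i` zero almost everywhere, and with it a whole row of
the matrix. Square-integrability matters, as the integral of a non-integrable square is `0` by
convention. The lemma keeps the threshold of the likelihood condition positive, because `0 ^ (-1/4)`
is `0` for real powers. -/
lemma maxDiagFisher_ne_zero {α : Type*} [MeasurableSpace α] (i : Fin d) {μ : Measure α}
    {S : α → EuclideanSpace ℝ (Fin d)} (hS : Measurable S)
    (hS2 : ∫⁻ x, ENNReal.ofReal (S x i ^ 2) ∂μ < ∞) (hdet : (fisherMatrix μ S).det ≠ 0) :
    maxDiagFisher μ S ≠ 0 := by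
  intro h0
  apply hdet
  have hSi : Measurable fun x => S x i := by fun_prop
  have hint := (memLp_two_of_lintegral_sq_lt_top hSi.aestronglyMeasurable hS2).integrable_sq
  have hle : ∫ x, S x i ^ 2 ∂μ ≤ 0 := by
    have : fisherMatrix μ S i i ≤ maxDiagFisher μ S :=
      le_ciSup (f := fun i => fisherMatrix μ S i i) (Set.finite_range _).bddAbove i
    rw [h0] at this
    simpa [fisherMatrix, sq] using this
  have h1 := (integral_eq_zero_iff_of_nonneg (fun x => sq_nonneg (S x i)) hint).1
    (le_antisymm hle (integral_nonneg fun x => sq_nonneg _))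
  refine Matrix.det_eq_zero_of_row_eq_zero i fun j => ?_
  simp only [fisherMatrix, Matrix.of_apply]
  refine integral_eq_zero_of_ae ?_
  filter_upwards [h1] with x hx
  have : S x i = 0 := by simpa using hx
  simp [this]

lemma eventually_cube_subset {Θ : Set (EuclideanSpace ℝ (Fin d))}
    {θ₀ : EuclideanSpace ℝ (Fin d)} (h : θ₀ ∈ interior Θ) :
    ∀ᶠ δ in 𝓝[>] (0 : ℝ), cube θ₀ δ ⊆ Θ := by
  have h1 : (WithLp.toLp 2 : (Fin d → ℝ) → EuclideanSpace ℝ (Fin d)) ⁻¹' Θ ∈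
      𝓝 (WithLp.ofLp θ₀) :=
    (PiLp.continuous_toLp 2 fun _ : Fin d => ℝ).continuousAt.preimage_mem_nhds
      (mem_interior_iff_mem_nhds.1 h)
  obtain ⟨r, hr, hrs⟩ := Metric.nhds_basis_closedBall.mem_iff.1 h1
  filter_upwards [Ioc_mem_nhdsGT hr] with δ hδ θ hθ
  have : WithLp.ofLp θ ∈ Metric.closedBall (WithLp.ofLp θ₀) r := by
    rw [Metric.mem_closedBall, dist_pi_le_iff hr.le]
    intro i
    rw [Real.dist_eq]
    exact (hθ i).trans hδ.2
  exact hrs this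

lemma absolutelyContinuous_of_pi {μ ν : Fin d → Measure 𝓧} [∀ i, IsProbabilityMeasure (μ i)]
    [∀ i, IsProbabilityMeasure (ν i)] (h : Measure.pi ν ≪ Measure.pi μ) (i : Fin d) :
    ν i ≪ μ i := by
  have := h.map (measurable_pi_apply i)
  rwa [(measurePreserving_eval ν i).map_eq, (measurePreserving_eval μ i).map_eq] at this

lemma vertex_mem_cube {t δ : ℝ} (hδ : 0 ≤ δ) (b : Fin d → Bool) :
    vertex t δ b ∈ cube (WithLp.toLp 2 fun _ => t) δ := by
  intro i
  simp only [vertex]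
  split_ifs
  · simp [abs_of_nonneg hδ]
  · simpa using hδ

lemma signVec_mem_cube {t δ : ℝ} (hδ : 0 ≤ δ) (u : Fin d → ℤˣ) :
    (WithLp.toLp 2 fun _ => t) + δ • signVec u ∈ cube (WithLp.toLp 2 fun _ => t) δ := by
  intro i
  rcases Int.units_eq_one_or (u i) with h | h <;> simp [signVec, h, abs_of_nonneg hδ]

/-- The supremum of the risk over a set which contains the vertices of a cube. -/
lemma ofReal_le_iSup_risk {n : ℕ} (Pi : BlackboardProtocol.{u, w} n 1 (Fin d → 𝓧))
    (T : Estimator Pi d) (p : ℝ → Measure 𝓧) {Θ : Set (EuclideanSpace ℝ (Fin d))} {t δ χ : ℝ}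
    [IsProbabilityMeasure (p t)] [IsProbabilityMeasure (p (t + δ))] (hac : p (t + δ) ≪ p t)
    (hδ : 0 ≤ δ) (hΘ : cube (WithLp.toLp 2 fun _ => t) δ ⊆ Θ) (hχ : 0 < χ)
    (hfχ : ∫⁻ x, ENNReal.ofReal ((((p (t + δ)).rnDeriv (p t) x).toReal - 1) ^ 2) ∂(p t) ≤
      ENNReal.ofReal χ) :
    ENNReal.ofReal (δ ^ 2 * (d / 4 - n * χ)) ≤
      ⨆ θ ∈ Θ, risk Pi T (productModel p θ) θ := by
  have h := sum_risk_ge Pi T (p t) (p (t + δ)) hac hχ hfχ t δ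
  have hb : ∀ b : Fin d → Bool, risk Pi T (vertexLaw (p t) (p (t + δ)) b) (vertex t δ b) ≤
      ⨆ θ ∈ Θ, risk Pi T (productModel p θ) θ := by
    intro b
    have e : vertexLaw (p t) (p (t + δ)) b = productModel p (vertex t δ b) := by
      unfold vertexLaw productModel vertex
      congr 1
      funext i
      exact (apply_ite p _ _ _).symm
    rw [e]
    exact le_iSup₂ (f := fun θ _ => risk Pi T (productModel p θ) θ) _ (hΘ (vertex_mem_cube hδ b))
  have h2 := h.trans (Finset.sum_le_sum fun b _ => hb b)
  rw [Finset.sum_const, Finset.card_univ, Fintype.card_fun, Fintype.card_bool, Fintype.card_fin,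
    nsmul_eq_mul, ENNReal.ofReal_mul (by positivity), ENNReal.ofReal_pow (by norm_num),
    Nat.cast_pow, ENNReal.ofReal_ofNat, Nat.cast_ofNat] at h2
  exact (ENNReal.mul_le_mul_iff_right (by simp) (by simp)).1 h2

/-- After taking fourth powers this is `d³ ≤ n²`. It places the side length of the cube within the
range of the likelihood condition. -/
lemma sqrt_le_rpow_neg_quarter {n d : ℕ} (hd : 0 < d) (hn : d ^ 2 ≤ n) {I : ℝ} (hI : 0 < I) :
    √((d : ℝ) / (n * I)) ≤ (I ^ 2 * (d : ℝ)) ^ (-(1 / 4) : ℝ) := by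
  have hd1 : (1 : ℝ) ≤ d := by exact_mod_cast hd
  have hn' : (d : ℝ) ^ 2 ≤ n := by exact_mod_cast hn
  have hn0 : (0 : ℝ) < n := lt_of_lt_of_le (by positivity) hn'
  have hx : 0 < I ^ 2 * (d : ℝ) := by positivity
  refine (pow_le_pow_iff_left₀ (Real.sqrt_nonneg _) (Real.rpow_nonneg hx.le _)
    (by norm_num : (4 : ℕ) ≠ 0)).1 ?_
  rw [← Real.rpow_mul_natCast hx.le, show (4 : ℕ) = 2 * 2 from rfl, pow_mul,
    Real.sq_sqrt (by positivity)]
  norm_num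
  rw [Real.rpow_neg_one, ← one_div, div_pow, div_le_div_iff₀ (by positivity) hx]
  have h3 : (d : ℝ) ^ 3 ≤ n ^ 2 := by
    calc (d : ℝ) ^ 3 ≤ d ^ 4 := pow_le_pow_right₀ hd1 (by norm_num)
      _ = (d ^ 2) ^ 2 := by ring
      _ ≤ n ^ 2 := pow_le_pow_left₀ (by positivity) hn' 2
  nlinarith [mul_le_mul_of_nonneg_right h3 (sq_nonneg I)]

/-- The numerical choice of the side length of the cube. -/
lemma n_mul_chiSq_le {n d : ℕ} (hd : 0 < d) (hn : d ^ 2 ≤ n) {I c c₀ δ : ℝ} (hI : 0 < I)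
    (hc0 : 0 < c) (hc₀ : 0 < c₀) (hc : c ≤ 1 / (4 * (1 + c₀)))
    (hδ : δ ^ 2 = c ^ 2 * (d / (n * I))) :
    n * (2 * (δ ^ 2 * I + c₀ * δ ^ 4 * I ^ 2 * d)) ≤ (d : ℝ) / 8 := by
  have hd0 : (0 : ℝ) < d := by exact_mod_cast hd
  have hn' : (d : ℝ) ^ 2 ≤ n := by exact_mod_cast hn
  have hn0 : (0 : ℝ) < n := lt_of_lt_of_le (by positivity) hn'
  -- Here `d² ≤ n` keeps the quartic term comparable to the quadratic one: the total is at most `2d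
  -- c² (1 + c₀)`, and `c² (1 + c₀) ≤ 1/16`.
  have e : n * (2 * (δ ^ 2 * I + c₀ * δ ^ 4 * I ^ 2 * d)) =
      2 * d * (c ^ 2 + c₀ * c ^ 4 * (d ^ 2 / n)) := by
    rw [show δ ^ 4 = (δ ^ 2) ^ 2 by ring, hδ]
    field_simp
  have h1 : (d : ℝ) ^ 2 / n ≤ 1 := (div_le_one hn0).2 hn'
  have h2 : c * (4 * (1 + c₀)) ≤ 1 := by rwa [le_div_iff₀ (by positivity)] at hc
  have h3 : c ≤ 1 := by nlinarith
  have h4 : c ^ 2 * (1 + c₀) ≤ 1 / 16 := by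
    have : (c * (4 * (1 + c₀))) ^ 2 ≤ 1 := pow_le_one₀ (by positivity) h2
    have h5 : c ^ 2 * (1 + c₀) ≤ c ^ 2 * (1 + c₀) ^ 2 :=
      mul_le_mul_of_nonneg_left (by nlinarith) (sq_nonneg c)
    nlinarith
  have h6 : c₀ * c ^ 4 * (d ^ 2 / n) ≤ c₀ * c ^ 2 := by
    calc c₀ * c ^ 4 * (d ^ 2 / n) ≤ c₀ * c ^ 4 * 1 :=
          mul_le_mul_of_nonneg_left h1 (by positivity)
      _ = c₀ * c ^ 2 * c ^ 2 := by ring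
      _ ≤ c₀ * c ^ 2 * 1 := mul_le_mul_of_nonneg_left (pow_le_one₀ hc0.le h3) (by positivity)
      _ = c₀ * c ^ 2 := by ring
  rw [e]
  nlinarith

end Minimax

end DistEst

end

/-! ### Choice of the side length and conclusion -/

theorem corollary1 :
    ∀ δ₀ c₀ ρ : ℝ, 0 < δ₀ → 0 < c₀ → 0 < ρ →
    ∃ C : ℝ, 0 < C ∧
      ∀ (𝓧 : Type u) [MeasurableSpace 𝓧] (n d : ℕ) (p : ℝ → Measure 𝓧)
        (Θ : Set (EuclideanSpace ℝ (Fin d))) (t₀ : ℝ)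
        (S : (Fin d → 𝓧) → EuclideanSpace ℝ (Fin d)) (s₀ : 𝓧 → ℝ),
        0 < d → d ^ 2 ≤ n →
        (∀ θ ∈ Θ, ∀ i, IsProbabilityMeasure (p (θ i))) →
        DistEst.RegularAt (DistEst.productModel p) Θ (WithLp.toLp 2 fun _ => t₀) S →
        DistEst.LikelihoodCondition (DistEst.productModel p) Θ (WithLp.toLp 2 fun _ => t₀) S
          δ₀ c₀ →
        DistEst.DiffQuadMean p t₀ s₀ →
        DistEst.cube (WithLp.toLp 2 fun _ => t₀)
          (ρ * √((d : ℝ) / ((n : ℝ) * DistEst.fisherInfo (p t₀) s₀))) ⊆ Θ →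
        ENNReal.ofReal (C * ((d : ℝ) ^ 2 / ((n : ℝ) * DistEst.fisherInfo (p t₀) s₀))) ≤
          DistEst.minimaxRisk.{u, w} (DistEst.productModel p) Θ n 1 := by
  open DistEst in
  intro δ₀ c₀ ρ hδ₀ hc₀ hρ
  -- The side length is `c √(d/(nI))`. The three bounds on `c` keep the cube in `Θ`, keep `δ`
  -- strictly below the likelihood threshold, and give `nχ ≤ d/8`.
  set c : ℝ := min (min ρ (δ₀ / 2)) (1 / (4 * (1 + c₀))) with hc
  have hc0 : 0 < c := by positivity
  have hcρ : c ≤ ρ := (min_le_left _ _).trans (min_le_left _ _)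
  have hcδ₀ : c ≤ δ₀ / 2 := (min_le_left _ _).trans (min_le_right _ _)
  have hcc₀ : c ≤ 1 / (4 * (1 + c₀)) := min_le_right _ _
  refine ⟨c ^ 2 / 8, by positivity, ?_⟩
  intro 𝓧 _ n d p Θ t₀ S s₀ hd hn hp hreg hlik hs hcube
  set θ₀ : EuclideanSpace ℝ (Fin d) := WithLp.toLp 2 fun _ => t₀ with hθ₀
  set I := fisherInfo (p t₀) s₀ with hI
  -- For `I = 0` the claimed bound is a division by zero, hence `0`. Otherwise `I ≠ 0` also shows
  -- that `s₀²` is integrable.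
  by_cases hI0 : I = 0
  · simp [hI0]
  have i₀ : Fin d := ⟨0, hd⟩
  have : Nonempty (Fin d) := ⟨i₀⟩
  have hpt₀ : IsProbabilityMeasure (p t₀) := hp θ₀ (interior_subset hreg.mem_interior) i₀
  have hd0 : (0 : ℝ) < d := by exact_mod_cast hd
  have hn0 : (0 : ℝ) < n := by
    have : (d : ℝ) ^ 2 ≤ n := by exact_mod_cast hn
    exact lt_of_lt_of_le (by positivity) this
  have hIpos : 0 < I := lt_of_le_of_ne (integral_nonneg fun x => sq_nonneg _) (Ne.symm hI0)
  have hs₀L : MemLp s₀ 2 (p t₀) := by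
    rw [memLp_two_iff_integrable_sq hs.measurable_score.aestronglyMeasurable]
    exact not_imp_comm.1 integral_undef hI0
  have hprob : ∀ δ, 0 ≤ δ → cube θ₀ δ ⊆ Θ → ∀ (e : ℤˣ),
      IsProbabilityMeasure (p (t₀ + δ * ((e : ℤ) : ℝ))) := by
    intro δ hδ hsub e
    have := hp _ (hsub (signVec_mem_cube hδ fun _ => e)) i₀
    simpa [signVec] using this
  have hac : ∀ δ, 0 ≤ δ → cube θ₀ δ ⊆ Θ →
      (∀ u : Fin d → ℤˣ, productModel p (θ₀ + δ • signVec u) ≪ productModel p θ₀) →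
      IsProbabilityMeasure (p (t₀ + δ)) ∧ p (t₀ + δ) ≪ p t₀ := by
    intro δ hδ hsub h
    have h1 := hprob δ hδ hsub 1
    have h2 := h fun _ => 1
    rw [hθ₀, productModel_signVec] at h2
    have h3 := absolutelyContinuous_of_pi (μ := fun _ : Fin d => p t₀)
      (ν := fun _ : Fin d => p (t₀ + δ * (((1 : ℤˣ) : ℤ) : ℝ))) h2 i₀
    simp only [Units.val_one, Int.cast_one, mul_one] at h1 h3
    exact ⟨h1, h3⟩
  -- This must precede `B = I`: the identification of the scores uses absolute continuity for small
  -- `r`, which the likelihood condition provides only below a positive threshold.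
  have hB : maxDiagFisher (productModel p θ₀) S ≠ 0 :=
    maxDiagFisher_ne_zero i₀ hreg.diffQuadMean.measurable_score
      (lintegral_score_sq_lt_top hp hreg.mem_interior hreg.diffQuadMean i₀) hreg.nonsingular
  have hbound : 0 < δ₀ * (maxDiagFisher (productModel p θ₀) S ^ 2 * (d : ℝ)) ^ (-(1 / 4) : ℝ) := by
    positivity
  have hev : ∀ᶠ r in 𝓝[>] (0 : ℝ), IsProbabilityMeasure (p (t₀ + r)) ∧ p (t₀ + r) ≪ p t₀ := by
    filter_upwards [eventually_cube_subset hreg.mem_interior, Ioo_mem_nhdsGT hbound]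
      with r hr hr'
    exact hac r hr'.1.le hr (hlik r hr'.1 hr hr'.2).1
  have hSs := fun i => score_ae_eq hev hreg.diffQuadMean hs i
  have hBI : maxDiagFisher (productModel p θ₀) S = I :=
    maxDiagFisher_eq_fisherInfo hs.measurable_score hSs
  set δ := c * √((d : ℝ) / (n * I)) with hδ
  have hδ0 : 0 < δ := by positivity
  have hδ2 : δ ^ 2 = c ^ 2 * (d / (n * I)) := by
    rw [hδ, mul_pow, Real.sq_sqrt (by positivity)]
  have hsub : cube θ₀ δ ⊆ Θ := fun θ hθ => hcube fun i =>
    (hθ i).trans (mul_le_mul_of_nonneg_right hcρ (Real.sqrt_nonneg _))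
  have hlt : δ < δ₀ * (maxDiagFisher (productModel p θ₀) S ^ 2 * (d : ℝ)) ^ (-(1 / 4) : ℝ) := by
    rw [hBI]
    rw [hBI] at hbound
    have h1 := mul_le_mul hcδ₀ (sqrt_le_rpow_neg_quarter hd hn hIpos) (Real.sqrt_nonneg _)
      (by positivity)
    have h2 : δ ≤ δ₀ / 2 * (I ^ 2 * (d : ℝ)) ^ (-(1 / 4) : ℝ) := h1
    linarith
  obtain ⟨hacu, hR⟩ := hlik δ hδ0 hsub hlt
  obtain ⟨hpδ, hacδ⟩ := hac δ hδ0.le hsub hacu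
  rw [hBI] at hR
  set N := c₀ * δ ^ 4 * I ^ 2 * d with hN
  have hN0 : 0 < N := by positivity
  have hχ := chiSq_le_of_test_functions (p t₀) (p (t₀ + δ)) hacδ
    (M := δ ^ 2 * I + N) (by positivity) fun g k hg hgk hg0 =>
    sq_integral_le_of_likelihoodKernel p hreg.diffQuadMean.measurable_score
      (hprob δ hδ0.le hsub) hs₀L hSs hacu hN0.le hR i₀ hg hgk hg0
  refine le_iInf₂ fun Pi T => ?_
  refine le_trans (ENNReal.ofReal_le_ofReal ?_)
    (ofReal_le_iSup_risk Pi T p hacδ hδ0.le hsub (by positivity) hχ)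
  have h1 := n_mul_chiSq_le hd hn hIpos hc0 hc₀ hcc₀ hδ2
  -- Half of the `d / 4` survives, so the risk is at least `δ² d / 8`, which is the choice `C = c² /
  -- 8`.
  have h2 : (d : ℝ) / 8 ≤ d / 4 - n * (2 * (δ ^ 2 * I + N)) := by linarith
  refine le_trans (le_of_eq ?_) (mul_le_mul_of_nonneg_left h2 (sq_nonneg δ))
  rw [hδ2]
  ring
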